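/- Let $d\ge 1$ be an integer and let $C[0,1]^d$ be the vector space of continuous functions $f:[0,1]^d\to\mathbb R$, with graph $G_f=\{(x,f(x)):x\in[0,1]^d\}\subset\mathbb R^{d+1}$. For a non-empty bounded set $F\subset\mathbb R^{n}$ let $N_\delta(F)$ be the number of closed cubes $\prod_i[m_i\delta,(m_i+1)\delta]$, $m\in\mathbb Z^n$, that meet $F$, and let $$\underline{\dim}_BF=\liminf_{\delta\to0^+}\frac{\log N_\delta(F)}{-\log\delta},\qquad \overline{\dim}_BF=\limsup_{\delta\to0^+}\frac{\log N_\delta(F)}{-\log\delta}.$$ For $\alpha\in[d,d+1]$ put $$C_\alpha[0,1]^d=\{f\in C[0,1]^d:\overline{\dim}_BG_f\le\alpha\},\qquad D_\alpha[0,1]^d=\{f\in C_\alpha[0,1]^d:\underline{\dim}_BG_f=\overline{\dim}_BG_f=\alpha\}.$$ For $f\in C[0,1]^d$ and real $\beta$ put $$\|f\|_{\beta,d}=\|f\|_\infty+\sup_{0<\delta\le1}\frac{\sum_{S\in\Delta_\delta^d}R_f(S)}{\delta^{1-\beta}}\in[0,\infty],$$ where $\Delta^d_\delta$ is the set of cubes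 $\prod_{i=1}^d[n_i\delta,(n_i+1)\delta]$ with integers $0\le n_i\le\lceil\delta^{-1}\rceil-1$ and $R_f(S)=\sup_{x,y\in S\cap[0,1]^d}|f(x)-f(y)|$. For $\alpha\in[d,d+1)$ the set $C_\alpha[0,1]^d$ is a linear subspace of $C[0,1]^d$, and it is a completely metrizable topological vector space with the complete metric $$d_{\alpha,d}(f,g)=\sum_{k=1}^\infty\min\{2^{-k},\|f-g\|_{\alpha+1/k,d}\}.$$ A subset $F$ of a completely metrizable real topological vector space $X$ is called $1$-prevalent if $F$ is a Borel set and there is a one-dimensional subspace $P\subseteq X$ such that $\mathcal L_P(X\setminus(F+x))=0$ for every $x\in X$, where $\mathcal L_P$ is one-dimensional Lebesgue measure on $P$. Then: (1) $D_{d+1}[0,1]^d$ is a $1$-prevalent subset of $C[0,1]^d$ with the sup norm metric. (2) For every $\alpha\in[d,d+1)$, $D_\alpha[0,1]^d$ is a $1$-prevalent subset of $(C_\alpha[0,1]^d,d_{\alpha,d})$. -/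

import Mathlib

namespace GraphDim

open Filter Topology
open scoped ENNReal

/-! ### Box dimensions of subsets of `ℝ^ι` -/

/-- The closed cube `∏ i, [m i * δ, (m i + 1) * δ]` of the `δ`-mesh. -/
def meshCube {ι : Type*} (δ : ℝ) (m : ι → ℤ) : Set (ι → ℝ) :=
  Set.Icc (fun i => (m i : ℝ) * δ) (fun i => ((m i : ℝ) + 1) * δ)

/-- `N_δ(F)`, the number of cubes of the `δ`-mesh that meet `F`
(a finite number when `F` is bounded and `δ > 0`). -/
noncomputable def meshCount {ι : Type*} (F : Set (ι → ℝ)) (δ : ℝ) : ℕ :=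
  {m : ι → ℤ | (meshCube δ m ∩ F).Nonempty}.ncard

/-- Lower box dimension of a bounded set, `liminf_{δ → 0+} log N_δ(F) / (-log δ)`. -/
noncomputable def lowerBoxDim {ι : Type*} (F : Set (ι → ℝ)) : EReal :=
  liminf (fun δ : ℝ => ((Real.log (meshCount F δ) / -Real.log δ : ℝ) : EReal)) (𝓝[>] 0)

/-- Upper box dimension of a bounded set, `limsup_{δ → 0+} log N_δ(F) / (-log δ)`. -/
noncomputable def upperBoxDim {ι : Type*} (F : Set (ι → ℝ)) : EReal :=
  limsup (fun δ : ℝ => ((Real.log (meshCount F δ) / -Real.log δ : ℝ) : EReal)) (𝓝[>] 0)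

/-! ### Continuous functions on the unit cube and their graphs -/

/-- The unit cube `[0,1]^d`. The space `C[0,1]^d` is `C(UnitCube d, ℝ)`, with the sup norm. -/
abbrev UnitCube (d : ℕ) : Type := Set.Icc (0 : Fin d → ℝ) 1

/-- The graph `{(x, f x) : x ∈ [0,1]^d}` as a subset of `ℝ^(d+1)`. -/
def graphSet {d : ℕ} (f : C(UnitCube d, ℝ)) : Set (Fin (d + 1) → ℝ) :=
  Set.range fun x : UnitCube d => (Fin.snoc (x : Fin d → ℝ) (f x) : Fin (d + 1) → ℝ)

/-- The functions whose graph has box dimension `α`: lower and upper box dimension both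
equal `α`. -/
def graphDimEq (d : ℕ) (α : ℝ) : Set C(UnitCube d, ℝ) :=
  {f | lowerBoxDim (graphSet f) = (α : EReal) ∧ upperBoxDim (graphSet f) = (α : EReal)}

/-- The range (oscillation) `sup {|f x - f y| : x, y ∈ S ∩ [0,1]^d}`. -/
noncomputable def osc {d : ℕ} (f : C(UnitCube d, ℝ)) (S : Set (Fin d → ℝ)) : ℝ≥0∞ :=
  ⨆ (x : UnitCube d) (_ : (x : Fin d → ℝ) ∈ S) (y : UnitCube d) (_ : (y : Fin d → ℝ) ∈ S),
    ENNReal.ofReal |f x - f y|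

/-- The sum of the ranges of `f` over the mesh cubes `∏ i, [n i * δ, (n i + 1) * δ]` with
`0 ≤ n i ≤ ⌈1/δ⌉ - 1`. -/
noncomputable def oscSum {d : ℕ} (f : C(UnitCube d, ℝ)) (δ : ℝ) : ℝ≥0∞ :=
  ∑ n : Fin d → Fin ⌈δ⁻¹⌉₊, osc f (meshCube δ fun i => ((n i : ℕ) : ℤ))

/-- The norm `‖f‖_{β,d} = ‖f‖_∞ + sup_{0 < δ ≤ 1} (∑_S R_f(S)) / δ^(1-β)`, which may be `∞`. -/
noncomputable def oscNorm {d : ℕ} (β : ℝ) (f : C(UnitCube d, ℝ)) : ℝ≥0∞ :=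
  ENNReal.ofReal ‖f‖ + ⨆ δ ∈ Set.Ioc (0 : ℝ) 1, oscSum f δ / ENNReal.ofReal (δ ^ (1 - β))

/-- `∑_{k ≥ 1} min {2^(-k), ‖f‖_{α + 1/k, d}}`, which is the distance from `f` to `0`. -/
noncomputable def distFun {d : ℕ} (α : ℝ) (f : C(UnitCube d, ℝ)) : ℝ≥0∞ :=
  ∑' k : ℕ, min ((2 : ℝ≥0∞)⁻¹ ^ (k + 1)) (oscNorm (α + 1 / ((k : ℝ) + 1)) f)

/-! ### Oscillations and mesh counts -/

theorem osc_le_iff {d : ℕ} {f : C(UnitCube d, ℝ)} {S : Set (Fin d → ℝ)} {c : ℝ≥0∞} :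
    osc f S ≤ c ↔ ∀ x y : UnitCube d, (x : Fin d → ℝ) ∈ S → (y : Fin d → ℝ) ∈ S →
      ENNReal.ofReal |f x - f y| ≤ c := by
  simp only [osc, iSup_le_iff]
  exact ⟨fun h x y hx hy => h x hx y hy, fun h x hx y hy => h x y hx hy⟩

theorem osc_mono {d : ℕ} (f : C(UnitCube d, ℝ)) {S T : Set (Fin d → ℝ)}
    (h : ∀ x : UnitCube d, (x : Fin d → ℝ) ∈ S → (x : Fin d → ℝ) ∈ T) : osc f S ≤ osc f T :=
  osc_le_iff.2 fun x y hx hy => osc_le_iff.1 le_rfl x y (h x hx) (h y hy)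

theorem osc_add {d : ℕ} (f g : C(UnitCube d, ℝ)) (S : Set (Fin d → ℝ)) :
    osc (f + g) S ≤ osc f S + osc g S := by
  refine osc_le_iff.2 fun x y hx hy => ?_
  refine le_trans ?_ (add_le_add (osc_le_iff.1 (le_refl (osc f S)) x y hx hy)
    (osc_le_iff.1 (le_refl (osc g S)) x y hx hy))
  rw [← ENNReal.ofReal_add (abs_nonneg _) (abs_nonneg _)]
  refine ENNReal.ofReal_le_ofReal ?_
  have : (f + g) x - (f + g) y = (f x - f y) + (g x - g y) := by
    simp only [ContinuousMap.add_apply]; ring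
  rw [this]
  exact abs_add_le _ _

theorem osc_smul {d : ℕ} (c : ℝ) (f : C(UnitCube d, ℝ)) (S : Set (Fin d → ℝ)) :
    osc (c • f) S ≤ ENNReal.ofReal |c| * osc f S := by
  refine osc_le_iff.2 fun x y hx hy => ?_
  refine le_trans ?_ (mul_le_mul_right (osc_le_iff.1 (le_refl (osc f S)) x y hx hy) _)
  rw [← ENNReal.ofReal_mul (abs_nonneg _), ← abs_mul]
  simp [mul_sub]

theorem osc_le_norm {d : ℕ} (f : C(UnitCube d, ℝ)) (S : Set (Fin d → ℝ)) :
    osc f S ≤ ENNReal.ofReal (2 * ‖f‖) := by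
  refine osc_le_iff.2 fun x y _ _ => ENNReal.ofReal_le_ofReal ?_
  have h1 := f.norm_coe_le_norm x
  have h2 := f.norm_coe_le_norm y
  rw [Real.norm_eq_abs] at h1 h2
  have := abs_sub (f x) (f y)
  linarith

/-- The number of mesh cubes over the column with base `meshCube δ p` that meet the graph. -/
noncomputable def colCount {d : ℕ} (f : C(UnitCube d, ℝ)) (δ : ℝ) (p : Fin d → ℤ) : ℕ :=
  {j : ℤ | ∃ x : UnitCube d, (x : Fin d → ℝ) ∈ meshCube δ p ∧
    (j : ℝ) * δ ≤ f x ∧ f x ≤ ((j : ℝ) + 1) * δ}.ncard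

theorem colCount_bounds {d : ℕ} (f : C(UnitCube d, ℝ)) {δ : ℝ} (hδ : 0 < δ) (p : Fin d → ℤ) :
    osc f (meshCube δ p) ≤ ENNReal.ofReal δ * colCount f δ p ∧
    ENNReal.ofReal δ * colCount f δ p ≤ osc f (meshCube δ p) + 2 * ENNReal.ofReal δ := by
  set K : Set (UnitCube d) := {x | (x : Fin d → ℝ) ∈ meshCube δ p} with hK
  have hJ : {j : ℤ | ∃ x : UnitCube d, (x : Fin d → ℝ) ∈ meshCube δ p ∧
      (j : ℝ) * δ ≤ f x ∧ f x ≤ ((j : ℝ) + 1) * δ} =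
      {j : ℤ | ∃ t ∈ f '' K, (j : ℝ) * δ ≤ t ∧ t ≤ ((j : ℝ) + 1) * δ} := by
    ext j; simp [hK]
  have hosc : osc f (meshCube δ p) = Metric.ediam (f '' K) := by
    apply le_antisymm
    · refine osc_le_iff.2 fun x y hx hy => ?_
      rw [← Real.dist_eq, ← edist_dist]
      exact Metric.edist_le_ediam_of_mem ⟨x, hx, rfl⟩ ⟨y, hy, rfl⟩
    · refine Metric.ediam_image_le_iff.2 fun x hx y hy => ?_
      rw [edist_dist, Real.dist_eq]
      exact osc_le_iff.1 le_rfl x y hx hy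
  rw [colCount, hJ, hosc]
  rcases K.eq_empty_or_nonempty with h0 | hne
  · simp [h0]
  have hKc : IsCompact K := by
    apply IsClosed.isCompact
    exact isClosed_Icc.preimage continuous_subtype_val
  have hKconn : IsPreconnected K := by
    have : IsPreconnected (Subtype.val '' K) := by
      have e : Subtype.val '' K = meshCube δ p ∩ Set.Icc 0 1 := by
        ext x
        constructor
        · rintro ⟨y, hy, rfl⟩; exact ⟨hy, y.2⟩
        · rintro ⟨h1, h2⟩; exact ⟨⟨x, h2⟩, h1, rfl⟩
      rw [e]
      exact ((convex_Icc _ _).inter (convex_Icc _ _)).isPreconnected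
    exact (Topology.IsInducing.subtypeVal.isPreconnected_image).1 this
  have hI := eq_Icc_of_connected_compact
    (IsConnected.image ⟨hne, hKconn⟩ f f.continuous.continuousOn) (hKc.image f.continuous)
  set a := sInf (f '' K)
  set b := sSup (f '' K)
  have hab : a ≤ b := by
    have : (Set.Icc a b).Nonempty := hI ▸ hne.image f
    exact Set.nonempty_Icc.1 this
  rw [hI, Real.ediam_Icc]
  have hset : {j : ℤ | ∃ t ∈ Set.Icc a b, (j : ℝ) * δ ≤ t ∧ t ≤ ((j : ℝ) + 1) * δ} =
      ((Finset.Icc (⌈a / δ⌉ - 1) ⌊b / δ⌋ : Finset ℤ) : Set ℤ) := by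
    ext j
    simp only [Set.mem_ofPred_eq, Finset.coe_Icc, Set.mem_Icc, Int.le_floor, sub_le_iff_le_add,
      Int.ceil_le, le_div_iff₀ hδ, div_le_iff₀ hδ]
    push_cast
    constructor
    · rintro ⟨t, ⟨h1, h2⟩, h3, h4⟩
      exact ⟨by linarith, by linarith⟩
    · rintro ⟨h1, h2⟩
      refine ⟨max a (j * δ), ⟨le_max_left _ _, max_le hab h2⟩, le_max_right _ _, max_le h1 ?_⟩
      nlinarith
  rw [hset, Set.ncard_coe_finset, Int.card_Icc]
  have c1 := Int.le_ceil (a / δ)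
  have c2 := Int.ceil_lt_add_one (a / δ)
  have c3 := Int.floor_le (b / δ)
  have c4 := Int.lt_floor_add_one (b / δ)
  have hdiv : a / δ ≤ b / δ := by gcongr
  have hnn : 0 ≤ ⌊b / δ⌋ + 1 - (⌈a / δ⌉ - 1) := by
    have : (-1 : ℝ) < (⌊b / δ⌋ + 1 - (⌈a / δ⌉ - 1) : ℤ) := by push_cast; linarith
    have : (-1 : ℤ) < (⌊b / δ⌋ + 1 - (⌈a / δ⌉ - 1) : ℤ) := by exact_mod_cast this
    omega
  have hcast : ((⌊b / δ⌋ + 1 - (⌈a / δ⌉ - 1)).toNat : ℝ) = ⌊b / δ⌋ - ⌈a / δ⌉ + 2 := by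
    have : (((⌊b / δ⌋ + 1 - (⌈a / δ⌉ - 1)).toNat : ℤ) : ℝ) =
      ((⌊b / δ⌋ + 1 - (⌈a / δ⌉ - 1) : ℤ) : ℝ) := by rw [Int.toNat_of_nonneg hnn]
    rw [← Int.cast_natCast, this]; push_cast; ring
  rw [← ENNReal.ofReal_natCast, hcast, ← ENNReal.ofReal_mul hδ.le,
    show (2 : ℝ≥0∞) = ENNReal.ofReal 2 by simp, ← ENNReal.ofReal_mul (by norm_num),
    ← ENNReal.ofReal_add (by linarith) (by linarith)]
  have e1 : b = δ * (b / δ) := by field_simp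
  have e2 : a = δ * (a / δ) := by field_simp
  constructor <;> apply ENNReal.ofReal_le_ofReal
  · calc b - a = δ * (b / δ - a / δ) := by rw [mul_sub, ← e1, ← e2]
      _ ≤ _ := by gcongr; linarith
  · calc δ * (⌊b / δ⌋ - ⌈a / δ⌉ + 2) ≤ δ * (b / δ - a / δ + 2) := by gcongr
      _ = (b - a) + 2 * δ := by rw [mul_add, mul_sub, ← e1, ← e2]; ring

/-- A finite set of columns that contains every column meeting the unit cube. -/
noncomputable def cols (d : ℕ) (δ : ℝ) : Finset (Fin d → ℤ) :=
  Fintype.piFinset fun _ => Finset.Icc (-1) (⌈δ⁻¹⌉₊ : ℤ)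

theorem mem_cols {d : ℕ} {δ : ℝ} (hδ : 0 < δ) {p : Fin d → ℤ} {x : UnitCube d}
    (hx : (x : Fin d → ℝ) ∈ meshCube δ p) : p ∈ cols d δ := by
  rw [cols, Fintype.mem_piFinset]
  intro i
  have h1 : (p i : ℝ) * δ ≤ x.1 i := hx.1 i
  have h2 : x.1 i ≤ ((p i : ℝ) + 1) * δ := hx.2 i
  have h3 : 0 ≤ x.1 i := x.2.1 i
  have h4 : x.1 i ≤ 1 := x.2.2 i
  rw [Finset.mem_Icc]
  constructor
  · have : (0 : ℝ) ≤ (p i : ℝ) + 1 := by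
      by_contra h
      push Not at h
      nlinarith
    have : (0 : ℤ) ≤ p i + 1 := by exact_mod_cast this
    omega
  · have : (p i : ℝ) ≤ δ⁻¹ := by
      rw [← one_div, le_div_iff₀ hδ]; linarith
    have : (p i : ℝ) ≤ (⌈δ⁻¹⌉₊ : ℝ) := this.trans (Nat.le_ceil _)
    exact_mod_cast this

theorem meshCount_eq {d : ℕ} (f : C(UnitCube d, ℝ)) {δ : ℝ} (hδ : 0 < δ) :
    meshCount (graphSet f) δ = ∑ p ∈ cols d δ, colCount f δ p := by
  classical
  have key : ∀ m : Fin (d + 1) → ℤ, (meshCube δ m ∩ graphSet f).Nonempty ↔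
      ∃ x : UnitCube d, (x : Fin d → ℝ) ∈ meshCube δ (Fin.init m) ∧
        (m (Fin.last d) : ℝ) * δ ≤ f x ∧ f x ≤ ((m (Fin.last d) : ℝ) + 1) * δ := by
    intro m
    constructor
    · rintro ⟨_, hm, x, rfl⟩
      refine ⟨x, ⟨fun i => ?_, fun i => ?_⟩, ?_, ?_⟩
      · simpa [Fin.init] using hm.1 i.castSucc
      · simpa [Fin.init] using hm.2 i.castSucc
      · simpa using hm.1 (Fin.last d)
      · simpa using hm.2 (Fin.last d)
    · rintro ⟨x, hx, h1, h2⟩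
      refine ⟨_, ⟨fun i => ?_, fun i => ?_⟩, x, rfl⟩
      · refine Fin.lastCases ?_ (fun i => ?_) i
        · simpa using h1
        · simpa [Fin.init] using hx.1 i
      · refine Fin.lastCases ?_ (fun i => ?_) i
        · simpa using h2
        · simpa [Fin.init] using hx.2 i
  have hfin : {m : Fin (d + 1) → ℤ | (meshCube δ m ∩ graphSet f).Nonempty}.Finite := by
    have hb : ∀ j : ℤ, ∀ x : UnitCube d, (j : ℝ) * δ ≤ f x → f x ≤ ((j : ℝ) + 1) * δ →
        j ∈ Set.Icc (⌈-‖f‖ / δ⌉ - 1) ⌊‖f‖ / δ⌋ := by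
      intro j x h1 h2
      have h3 := f.norm_coe_le_norm x
      rw [Real.norm_eq_abs, abs_le] at h3
      simp only [Set.mem_Icc, Int.le_floor, sub_le_iff_le_add,
        Int.ceil_le, le_div_iff₀ hδ, div_le_iff₀ hδ]
      push_cast
      constructor <;> linarith [h3.1, h3.2]
    refine Set.Finite.subset ((Set.finite_Icc (⌈-‖f‖ / δ⌉ - 1) ⌊‖f‖ / δ⌋).image2
      (fun j (p : Fin d → ℤ) => (Fin.snoc p j : Fin (d + 1) → ℤ)) (cols d δ).finite_toSet) ?_
    intro m hm
    obtain ⟨x, hx, h1, h2⟩ := (key m).1 hm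
    exact ⟨m (Fin.last d), hb _ x h1 h2, Fin.init m, mem_cols hδ hx, Fin.snoc_init_self m⟩
  rw [meshCount, Set.ncard_eq_toFinset_card _ hfin,
    Finset.card_eq_sum_card_fiberwise (f := fun m => (Fin.init m : Fin d → ℤ)) (t := cols d δ)]
  · refine Finset.sum_congr rfl fun p _ => ?_
    rw [colCount, ← Set.ncard_coe_finset]
    refine Set.ncard_congr (fun m _ => m (Fin.last d)) ?_ ?_ ?_
    · intro m hm
      simp only [Finset.coe_filter, Set.Finite.mem_toFinset, Set.mem_ofPred_eq] at hm
      rw [key] at hm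
      obtain ⟨hm, rfl⟩ := hm
      exact hm
    · intro m m' hm hm' h
      simp only [Finset.coe_filter, Set.mem_ofPred_eq] at hm hm'
      rw [← Fin.snoc_init_self m, ← Fin.snoc_init_self m', hm.2, hm'.2]
      congr 1
    · intro j hj
      refine ⟨Fin.snoc p j, ?_, by simp⟩
      simp only [Finset.coe_filter, Set.Finite.mem_toFinset, Set.mem_ofPred_eq]
      rw [key]
      simpa using hj
  · intro m hm
    simp only [Set.Finite.coe_toFinset, Set.mem_ofPred_eq] at hm
    obtain ⟨x, hx, -⟩ := (key m).1 hm
    exact mem_cols hδ hx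

theorem oscSum_le {d : ℕ} (f : C(UnitCube d, ℝ)) {δ : ℝ} (hδ : 0 < δ) :
    oscSum f δ ≤ ENNReal.ofReal δ * meshCount (graphSet f) δ := by
  classical
  rw [meshCount_eq f hδ, Nat.cast_sum, Finset.mul_sum]
  refine (Finset.sum_le_sum fun n _ => (colCount_bounds f hδ _).1).trans ?_
  rw [← Finset.sum_image (s := Finset.univ)
    (g := fun (n : Fin d → Fin ⌈δ⁻¹⌉₊) (i : Fin d) => ((n i : ℕ) : ℤ))
    (f := fun p => ENNReal.ofReal δ * (colCount f δ p : ℝ≥0∞))]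
  · refine Finset.sum_le_sum_of_subset fun p hp => ?_
    obtain ⟨n, -, rfl⟩ := Finset.mem_image.1 hp
    rw [cols, Fintype.mem_piFinset]
    intro i
    have := (n i).2
    rw [Finset.mem_Icc]
    omega
  · intro n _ n' _ h
    funext i
    have := congrFun h i
    simp only [Nat.cast_inj] at this
    exact Fin.ext this

theorem meshCount_le {d : ℕ} (f : C(UnitCube d, ℝ)) {δ : ℝ} (hδ : 0 < δ) :
    ENNReal.ofReal δ * meshCount (graphSet f) δ ≤
      3 ^ d * oscSum f δ + 2 * ENNReal.ofReal δ * (⌈δ⁻¹⌉₊ + 2) ^ d := by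
  classical
  rw [meshCount_eq f hδ, Nat.cast_sum, Finset.mul_sum]
  refine (Finset.sum_le_sum fun p _ => (colCount_bounds f hδ p).2).trans ?_
  rw [Finset.sum_add_distrib]
  have hM : 0 < ⌈δ⁻¹⌉₊ := Nat.ceil_pos.2 (inv_pos.2 hδ)
  have hMδ : 1 ≤ (⌈δ⁻¹⌉₊ : ℝ) * δ := by
    have := Nat.le_ceil δ⁻¹
    calc (1 : ℝ) = δ⁻¹ * δ := by field_simp
      _ ≤ _ := by gcongr
  set M := ⌈δ⁻¹⌉₊
  refine add_le_add ?_ ?_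
  · -- move the boundary columns inside
    let cl : (Fin d → ℤ) → (Fin d → Fin M) := fun p i =>
      ⟨(max 0 (min (p i) (M - 1))).toNat, by omega⟩
    have hcl : ∀ p i, (((cl p i : ℕ) : ℤ)) = max 0 (min (p i) (M - 1)) := by
      intro p i
      simp only [cl]
      omega
    have h1 : ∀ p ∈ cols d δ, osc f (meshCube δ p) ≤
        osc f (meshCube δ fun i => ((cl p i : ℕ) : ℤ)) := by
      intro p hp
      rw [cols, Fintype.mem_piFinset] at hp
      refine osc_mono f fun x hx => ?_
      have hx1 : ∀ i, (p i : ℝ) * δ ≤ x.1 i := hx.1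
      have hx2 : ∀ i, x.1 i ≤ ((p i : ℝ) + 1) * δ := hx.2
      have hx3 : ∀ i, 0 ≤ x.1 i := x.2.1
      have hx4 : ∀ i, x.1 i ≤ 1 := x.2.2
      have hpi : ∀ i, ((((cl p i : ℕ) : ℤ) : ℝ) * δ ≤ x.1 i) ∧
          x.1 i ≤ ((((cl p i : ℕ) : ℤ) : ℝ) + 1) * δ := by
        intro i
        have hb := Finset.mem_Icc.1 (hp i)
        rw [hcl p i]
        rcases lt_trichotomy (p i) (-1) with h | h | h
        · omega
        · have e : max 0 (min (p i) ((M : ℤ) - 1)) = 0 := by omega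
          rw [e]
          have := hx2 i
          rw [h] at this
          push_cast at this ⊢
          constructor <;> nlinarith [hx3 i]
        · by_cases h' : p i = M
          · have e : max 0 (min (p i) ((M : ℤ) - 1)) = (M : ℤ) - 1 := by omega
            rw [e]
            have := hx1 i
            rw [h'] at this
            push_cast at this ⊢
            constructor <;> nlinarith [hx4 i]
          · have hb2 : p i ≤ (M : ℤ) := hb.2
            have e : max 0 (min (p i) ((M : ℤ) - 1)) = p i := by omega
            rw [e]
            exact ⟨hx1 i, hx2 i⟩
      exact ⟨fun i => (hpi i).1, fun i => (hpi i).2⟩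
    refine (Finset.sum_le_sum h1).trans ?_
    rw [← Finset.sum_fiberwise_of_maps_to (s := cols d δ) (t := Finset.univ) (g := cl)
      (fun _ _ => Finset.mem_univ _), oscSum, Finset.mul_sum]
    refine Finset.sum_le_sum fun n _ => ?_
    have h2 : ∀ p ∈ (cols d δ).filter (fun p => cl p = n),
        osc f (meshCube δ fun i => ((cl p i : ℕ) : ℤ)) =
        osc f (meshCube δ fun i => ((n i : ℕ) : ℤ)) := by
      intro p hp
      rw [(Finset.mem_filter.1 hp).2]
    rw [Finset.sum_congr rfl h2, Finset.sum_const, nsmul_eq_mul]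
    gcongr
    have h3 : (cols d δ).filter (fun p => cl p = n) ⊆
        Fintype.piFinset fun i => Finset.Icc (((n i : ℕ) : ℤ) - 1) (((n i : ℕ) : ℤ) + 1) := by
      intro p hp
      obtain ⟨hpc, rfl⟩ := Finset.mem_filter.1 hp
      rw [cols, Fintype.mem_piFinset] at hpc
      rw [Fintype.mem_piFinset]
      intro i
      have hb := Finset.mem_Icc.1 (hpc i)
      have hb2 : p i ≤ (M : ℤ) := hb.2
      rw [Finset.mem_Icc, hcl p i]
      omega
    have h4 := Finset.card_le_card h3
    rw [Fintype.card_piFinset] at h4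
    have h5 : ∀ i : Fin d, (Finset.Icc (((n i : ℕ) : ℤ) - 1) (((n i : ℕ) : ℤ) + 1)).card = 3 := by
      intro i; rw [Int.card_Icc]; omega
    simp only [h5, Finset.prod_const, Finset.card_univ, Fintype.card_fin] at h4
    exact_mod_cast h4
  · rw [Finset.sum_const, nsmul_eq_mul, mul_comm]
    gcongr
    rw [cols, Fintype.card_piFinset]
    simp only [Int.card_Icc, Finset.prod_const, Finset.card_univ, Fintype.card_fin]
    push_cast
    gcongr
    have : ((⌈δ⁻¹⌉₊ : ℤ) + 1 - -1).toNat = M + 2 := by omega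
    rw [this]; push_cast; rfl

theorem oscSum_add {d : ℕ} (f g : C(UnitCube d, ℝ)) (δ : ℝ) :
    oscSum (f + g) δ ≤ oscSum f δ + oscSum g δ := by
  rw [oscSum, oscSum, oscSum, ← Finset.sum_add_distrib]
  exact Finset.sum_le_sum fun n _ => osc_add f g _

theorem oscSum_smul {d : ℕ} (c : ℝ) (f : C(UnitCube d, ℝ)) (δ : ℝ) :
    oscSum (c • f) δ ≤ ENNReal.ofReal |c| * oscSum f δ := by
  rw [oscSum, oscSum, Finset.mul_sum]
  exact Finset.sum_le_sum fun n _ => osc_smul c f _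

/-! ### The norms `‖·‖_{β,d}` -/

theorem oscSum_div_le {d : ℕ} (β : ℝ) (f : C(UnitCube d, ℝ)) {δ : ℝ}
    (hδ : δ ∈ Set.Ioc (0 : ℝ) 1) :
    oscSum f δ / ENNReal.ofReal (δ ^ (1 - β)) ≤ oscNorm β f :=
  (le_iSup₂ (f := fun δ (_ : δ ∈ Set.Ioc (0 : ℝ) 1) =>
    oscSum f δ / ENNReal.ofReal (δ ^ (1 - β))) δ hδ).trans le_add_self

theorem norm_le_oscNorm {d : ℕ} (β : ℝ) (f : C(UnitCube d, ℝ)) :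
    ENNReal.ofReal ‖f‖ ≤ oscNorm β f := le_self_add

theorem oscNorm_add {d : ℕ} (β : ℝ) (f g : C(UnitCube d, ℝ)) :
    oscNorm β (f + g) ≤ oscNorm β f + oscNorm β g := by
  have h1 : ENNReal.ofReal ‖f + g‖ ≤ ENNReal.ofReal ‖f‖ + ENNReal.ofReal ‖g‖ := by
    rw [← ENNReal.ofReal_add (norm_nonneg _) (norm_nonneg _)]
    exact ENNReal.ofReal_le_ofReal (norm_add_le _ _)
  refine (add_le_add h1 (iSup₂_le fun δ hδ => ?_)).trans_eq (add_add_add_comm _ _ _ _)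
  refine (ENNReal.div_le_div_right (oscSum_add f g δ) _).trans ?_
  rw [ENNReal.add_div]
  exact add_le_add
    (le_iSup₂ (f := fun δ (_ : δ ∈ Set.Ioc (0 : ℝ) 1) =>
      oscSum f δ / ENNReal.ofReal (δ ^ (1 - β))) δ hδ)
    (le_iSup₂ (f := fun δ (_ : δ ∈ Set.Ioc (0 : ℝ) 1) =>
      oscSum g δ / ENNReal.ofReal (δ ^ (1 - β))) δ hδ)

theorem oscNorm_smul {d : ℕ} (β c : ℝ) (f : C(UnitCube d, ℝ)) :
    oscNorm β (c • f) ≤ ENNReal.ofReal |c| * oscNorm β f := by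
  rw [oscNorm, oscNorm, mul_add, ← ENNReal.ofReal_mul (abs_nonneg _), norm_smul, Real.norm_eq_abs]
  refine add_le_add le_rfl (iSup₂_le fun δ hδ => ?_)
  refine (ENNReal.div_le_div_right (oscSum_smul c f δ) _).trans ?_
  rw [mul_div_assoc]
  gcongr
  exact le_iSup₂ (f := fun δ (_ : δ ∈ Set.Ioc (0 : ℝ) 1) =>
      oscSum f δ / ENNReal.ofReal (δ ^ (1 - β))) δ hδ

theorem oscNorm_zero {d : ℕ} (β : ℝ) : oscNorm β (0 : C(UnitCube d, ℝ)) = 0 := by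
  have := oscNorm_smul β 0 (0 : C(UnitCube d, ℝ))
  simpa using this

theorem oscNorm_neg {d : ℕ} (β : ℝ) (f : C(UnitCube d, ℝ)) : oscNorm β (-f) = oscNorm β f := by
  have h : ∀ g : C(UnitCube d, ℝ), oscNorm β (-g) ≤ oscNorm β g := fun g => by
    have := oscNorm_smul β (-1) g
    simpa using this
  exact le_antisymm (h f) (by simpa using h (-f))

theorem lowerSemicontinuous_oscNorm {d : ℕ} (β : ℝ) :
    LowerSemicontinuous fun f : C(UnitCube d, ℝ) => oscNorm β f := by
  refine LowerSemicontinuous.add ?_ ?_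
  · exact (ENNReal.continuous_ofReal.comp continuous_norm).lowerSemicontinuous
  · refine lowerSemicontinuous_biSup fun δ hδ => ?_
    have h1 : LowerSemicontinuous fun f : C(UnitCube d, ℝ) => oscSum f δ := by
      refine lowerSemicontinuous_sum fun n _ => ?_
      refine lowerSemicontinuous_biSup fun x hx => lowerSemicontinuous_biSup fun y hy => ?_
      refine Continuous.lowerSemicontinuous (ENNReal.continuous_ofReal.comp ?_)
      exact ((continuous_eval_const x).sub
        (continuous_eval_const y)).abs
    have hpos : ENNReal.ofReal (δ ^ (1 - β)) ≠ 0 :=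
      (ENNReal.ofReal_pos.2 (Real.rpow_pos_of_pos hδ.1 _)).ne'
    exact (ENNReal.continuous_div_const _ hpos).comp_lowerSemicontinuous h1
      (fun a b h => ENNReal.div_le_div_right h _)

/-- The dimension bound in terms of the norms. -/
theorem upperBoxDim_le_iff {d : ℕ} {α : ℝ} (hα : (d : ℝ) ≤ α) (f : C(UnitCube d, ℝ)) :
    upperBoxDim (graphSet f) ≤ (α : EReal) ↔
      ∀ k : ℕ, oscNorm (α + 1 / ((k : ℝ) + 1)) f < ∞ := by
  have hIoo : ∀ {a : ℝ}, 0 < a → ∀ᶠ δ : ℝ in 𝓝[>] 0, δ ∈ Set.Ioo 0 a := fun h =>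
    Ioo_mem_nhdsGT h
  have hd0 : (0 : ℝ) ≤ d := Nat.cast_nonneg d
  constructor
  · intro h k
    set β := α + 1 / ((k : ℝ) + 1) with hβ
    have hαβ : α < β := by rw [hβ]; linarith [Nat.one_div_pos_of_nat (α := ℝ) (n := k)]
    have h1 : upperBoxDim (graphSet f) < (β : EReal) :=
      h.trans_lt (EReal.coe_lt_coe_iff.2 hαβ)
    have h2 := eventually_lt_of_limsup_lt h1
    obtain ⟨a, ha, h3⟩ : ∃ a > (0 : ℝ), ∀ δ ∈ Set.Ioo 0 a,
        Real.log (meshCount (graphSet f) δ) / -Real.log δ < β := by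
      obtain ⟨a, ha, h3⟩ := (mem_nhdsGT_iff_exists_Ioo_subset).1 h2
      exact ⟨a, ha, fun δ hδ => EReal.coe_lt_coe_iff.1 (h3 hδ)⟩
    set b := min a 1 with hb
    have hb0 : 0 < b := lt_min ha one_pos
    refine ENNReal.add_lt_top.2 ⟨ENNReal.ofReal_lt_top, ?_⟩
    refine lt_of_le_of_lt (b := 1 + (⌈b⁻¹⌉₊ : ℝ≥0∞) ^ d * ENNReal.ofReal (2 * ‖f‖) /
      ENNReal.ofReal b) (iSup₂_le fun δ hδ => ?_) ?_
    · have hpos : 0 < δ ^ (1 - β) := Real.rpow_pos_of_pos hδ.1 _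
      by_cases hδb : δ < b
      · refine le_trans ?_ le_self_add
        apply ENNReal.div_le_of_le_mul
        rw [one_mul]
        refine (oscSum_le f hδ.1).trans ?_
        rw [← ENNReal.ofReal_natCast, ← ENNReal.ofReal_mul hδ.1.le]
        apply ENNReal.ofReal_le_ofReal
        have h4 := h3 δ ⟨hδ.1, hδb.trans_le (min_le_left _ _)⟩
        have hlog : Real.log δ < 0 :=
          Real.log_neg hδ.1 (hδb.trans_le (min_le_right _ _))
        rw [div_lt_iff₀ (by linarith)] at h4
        rw [Real.rpow_sub hδ.1, Real.rpow_one, div_eq_mul_inv, ← Real.rpow_neg hδ.1.le]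
        refine mul_le_mul_of_nonneg_left ?_ hδ.1.le
        rcases Nat.eq_zero_or_pos (meshCount (graphSet f) δ) with h0 | h0
        · rw [h0]; simpa using (Real.rpow_pos_of_pos hδ.1 _).le
        · rw [Real.le_rpow_iff_log_le (by exact_mod_cast h0) hδ.1]
          linarith
      · push Not at hδb
        refine le_trans ?_ le_add_self
        refine ENNReal.div_le_div ?_ ?_
        · refine (Finset.sum_le_sum fun n _ => osc_le_norm f _).trans ?_
          rw [Finset.sum_const, nsmul_eq_mul]
          gcongr
          simp only [Finset.card_univ, Fintype.card_pi, Fintype.card_fin, Finset.prod_const]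
          push_cast
          have : ⌈δ⁻¹⌉₊ ≤ ⌈b⁻¹⌉₊ := Nat.ceil_mono (inv_anti₀ hb0 hδb)
          gcongr
        · apply ENNReal.ofReal_le_ofReal
          refine hδb.trans ?_
          calc δ = δ ^ (1 : ℝ) := (Real.rpow_one δ).symm
            _ ≤ _ := Real.rpow_le_rpow_of_exponent_ge hδ.1 hδ.2 (by linarith)
    · refine ENNReal.add_lt_top.2 ⟨ENNReal.one_lt_top, ?_⟩
      apply ENNReal.div_lt_top
      · exact ENNReal.mul_ne_top (by simp) ENNReal.ofReal_ne_top
      · exact (ENNReal.ofReal_pos.2 hb0).ne'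
  · intro h
    have step : ∀ k : ℕ, upperBoxDim (graphSet f) ≤ ((α + 2 / ((k : ℝ) + 1) : ℝ) : EReal) := by
      intro k
      have hk := h k
      have hk0 : 0 < 1 / ((k : ℝ) + 1) := Nat.one_div_pos_of_nat
      have hsplit : α + 2 / ((k : ℝ) + 1) = α + 1 / ((k : ℝ) + 1) + 1 / ((k : ℝ) + 1) := by ring
      rw [hsplit]
      set ε := 1 / ((k : ℝ) + 1)
      set β := α + ε with hβ
      set C : ℝ := 3 ^ d * (oscNorm β f).toReal + 2 * 4 ^ d with hC
      have hC0 : 0 < C := by positivity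
      have hbound : ∀ δ ∈ Set.Ioo (0 : ℝ) 1,
          (meshCount (graphSet f) δ : ℝ) ≤ C * δ ^ (-β) := by
        intro δ hδ
        have h1 := meshCount_le f hδ.1
        have h2 : oscSum f δ ≤ oscNorm β f * ENNReal.ofReal (δ ^ (1 - β)) := by
          have hp : ENNReal.ofReal (δ ^ (1 - β)) ≠ 0 :=
            (ENNReal.ofReal_pos.2 (Real.rpow_pos_of_pos hδ.1 _)).ne'
          exact (ENNReal.div_le_iff hp ENNReal.ofReal_ne_top).1
            (oscSum_div_le β f ⟨hδ.1, hδ.2.le⟩)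
        have h3 : ENNReal.ofReal δ * meshCount (graphSet f) δ ≤
            3 ^ d * (oscNorm β f * ENNReal.ofReal (δ ^ (1 - β))) +
              2 * ENNReal.ofReal δ * (⌈δ⁻¹⌉₊ + 2) ^ d := h1.trans (by gcongr)
        have h4 := ENNReal.toReal_mono (by
          refine ENNReal.add_ne_top.2 ⟨?_, ?_⟩
          · exact ENNReal.mul_ne_top (by simp) (ENNReal.mul_ne_top hk.ne ENNReal.ofReal_ne_top)
          · exact ENNReal.mul_ne_top (ENNReal.mul_ne_top (by simp) ENNReal.ofReal_ne_top)
              (by finiteness)) h3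
        rw [ENNReal.toReal_add
          (ENNReal.mul_ne_top (by simp) (ENNReal.mul_ne_top hk.ne ENNReal.ofReal_ne_top))
          (ENNReal.mul_ne_top (ENNReal.mul_ne_top (by simp) ENNReal.ofReal_ne_top)
              (by finiteness))] at h4
        have hcast : ((⌈δ⁻¹⌉₊ : ℝ≥0∞) + 2) = ((⌈δ⁻¹⌉₊ + 2 : ℕ) : ℝ≥0∞) := by push_cast; rfl
        have hp := Real.rpow_pos_of_pos hδ.1 (1 - β)
        rw [hcast] at h4
        simp only [ENNReal.toReal_mul, ENNReal.toReal_pow, ENNReal.toReal_ofNat,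
          ENNReal.toReal_natCast, ENNReal.toReal_ofReal hδ.1.le, ENNReal.toReal_ofReal hp.le] at h4
        have h5 : ((⌈δ⁻¹⌉₊ + 2 : ℕ) : ℝ) ≤ 4 * δ⁻¹ := by
          have h6 := (Nat.ceil_lt_add_one (inv_pos.2 hδ.1).le).le
          have h7 : 1 ≤ δ⁻¹ := (one_le_inv₀ hδ.1).2 hδ.2.le
          push_cast
          linarith
        have h6 : ((⌈δ⁻¹⌉₊ + 2 : ℕ) : ℝ) ^ d ≤ 4 ^ d * δ ^ (-β) := by
          calc ((⌈δ⁻¹⌉₊ + 2 : ℕ) : ℝ) ^ d ≤ (4 * δ⁻¹) ^ d := by gcongr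
            _ = 4 ^ d * δ ^ (-(d : ℝ)) := by
              rw [mul_pow, inv_pow, Real.rpow_neg hδ.1.le, Real.rpow_natCast]
            _ ≤ _ := by
              gcongr 4 ^ d * ?_
              exact Real.rpow_le_rpow_of_exponent_ge hδ.1 hδ.2.le (by linarith)
        have h7 : δ ^ (1 - β) = δ * δ ^ (-β) := by
          rw [sub_eq_add_neg, Real.rpow_add hδ.1, Real.rpow_one]
        rw [h7] at h4
        have h8 : δ * (meshCount (graphSet f) δ : ℝ) ≤ δ * (C * δ ^ (-β)) := by
          refine h4.trans ?_
          have : 2 * δ * ((⌈δ⁻¹⌉₊ + 2 : ℕ) : ℝ) ^ d ≤ 2 * δ * (4 ^ d * δ ^ (-β)) :=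
            mul_le_mul_of_nonneg_left h6 (by linarith [hδ.1])
          rw [hC]
          linarith
        exact le_of_mul_le_mul_left h8 hδ.1
      refine limsup_le_of_le (h := ?_)
      -- eventually `log C ≤ ε * (-log δ)`
      have hlim : Tendsto (fun δ : ℝ => -Real.log δ) (𝓝[>] 0) atTop :=
        tendsto_neg_atBot_atTop.comp Real.tendsto_log_nhdsGT_zero
      filter_upwards [hIoo one_pos, hlim.eventually_ge_atTop (Real.log C / ε)] with δ hδ hl
      rw [EReal.coe_le_coe_iff]
      have hlog : 0 < -Real.log δ := by linarith [Real.log_neg hδ.1 hδ.2]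
      rw [div_le_iff₀ hlog]
      rw [div_le_iff₀ hk0] at hl
      rcases Nat.eq_zero_or_pos (meshCount (graphSet f) δ) with h0 | h0
      · rw [h0]
        simp only [Nat.cast_zero, Real.log_zero]
        have : 0 ≤ β + ε := by linarith
        positivity
      · have h9 := Real.log_le_log (by exact_mod_cast h0) (hbound δ hδ)
        rw [Real.log_mul hC0.ne' (Real.rpow_pos_of_pos hδ.1 _).ne', Real.log_rpow hδ.1] at h9
        linarith
    refine ge_of_tendsto' (x := atTop) (f := fun k : ℕ =>
      ((α + 2 / ((k : ℝ) + 1) : ℝ) : EReal)) ?_ step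
    refine (continuous_coe_real_ereal.tendsto α).comp ?_
    have := (tendsto_one_div_add_atTop_nhds_zero_nat (𝕜 := ℝ)).const_mul 2
    have := this.const_add α
    simpa [div_eq_mul_inv] using this

/-! ### The metric space `(C_α[0,1]^d, d_{α,d})` -/

theorem distFun_zero {d : ℕ} (α : ℝ) : distFun α (0 : C(UnitCube d, ℝ)) = 0 := by
  simp [distFun, oscNorm_zero]

theorem distFun_neg {d : ℕ} (α : ℝ) (f : C(UnitCube d, ℝ)) : distFun α (-f) = distFun α f := by
  simp [distFun, oscNorm_neg]

theorem distFun_add {d : ℕ} (α : ℝ) (f g : C(UnitCube d, ℝ)) :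
    distFun α (f + g) ≤ distFun α f + distFun α g := by
  rw [distFun, distFun, distFun, ← ENNReal.tsum_add]
  refine ENNReal.tsum_le_tsum fun k => ?_
  refine (min_le_min le_rfl (oscNorm_add _ f g)).trans ?_
  rcases le_total ((2 : ℝ≥0∞)⁻¹ ^ (k + 1)) (oscNorm (α + 1 / ((k : ℝ) + 1)) f) with h1 | h1
  · rw [min_eq_left h1]; exact (min_le_left _ _).trans le_self_add
  · rcases le_total ((2 : ℝ≥0∞)⁻¹ ^ (k + 1)) (oscNorm (α + 1 / ((k : ℝ) + 1)) g) with h2 | h2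
    · rw [min_eq_left h2]; exact (min_le_left _ _).trans le_add_self
    · rw [min_eq_right h1, min_eq_right h2]; exact min_le_right _ _

theorem distFun_smul {d : ℕ} (α c : ℝ) (f : C(UnitCube d, ℝ)) :
    distFun α (c • f) ≤ max 1 (ENNReal.ofReal |c|) * distFun α f := by
  rw [distFun, distFun, ← ENNReal.tsum_mul_left]
  refine ENNReal.tsum_le_tsum fun k => ?_
  refine (min_le_min le_rfl (oscNorm_smul _ c f)).trans ?_
  rw [mul_min]
  refine min_le_min ?_ ?_
  · exact le_mul_of_one_le_left (zero_le) (le_max_left _ _)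
  · gcongr; exact le_max_right _ _

theorem tsum_half_pow : ∑' k : ℕ, (2 : ℝ≥0∞)⁻¹ ^ (k + 1) = 1 := by
  rw [ENNReal.tsum_geometric_add_one, ENNReal.one_sub_inv_two, inv_inv]
  exact ENNReal.inv_mul_cancel two_ne_zero ENNReal.ofNat_ne_top

theorem half_pow_pos (n : ℕ) : (0 : ℝ≥0∞) < (2 : ℝ≥0∞)⁻¹ ^ n :=
  ENNReal.pow_pos (ENNReal.inv_pos.2 ENNReal.ofNat_ne_top) n

theorem distFun_ne_top {d : ℕ} (α : ℝ) (f : C(UnitCube d, ℝ)) : distFun α f ≠ ∞ := by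
  refine ((ENNReal.tsum_le_tsum fun k => min_le_left _ _).trans_eq tsum_half_pow).trans_lt
    ENNReal.one_lt_top |>.ne

theorem oscNorm_le_of_distFun {d : ℕ} {α : ℝ} {f : C(UnitCube d, ℝ)} {k : ℕ} {ε : ℝ≥0∞}
    (h : distFun α f ≤ ε) (hε : ε < (2 : ℝ≥0∞)⁻¹ ^ (k + 1)) :
    oscNorm (α + 1 / ((k : ℝ) + 1)) f ≤ ε := by
  have h1 : min ((2 : ℝ≥0∞)⁻¹ ^ (k + 1)) (oscNorm (α + 1 / ((k : ℝ) + 1)) f) ≤ ε :=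
    (ENNReal.le_tsum k).trans h
  rcases min_le_iff.1 h1 with h2 | h2
  · exact absurd h2 (not_le.2 hε)
  · exact h2

theorem lowerSemicontinuous_distFun {d : ℕ} (α : ℝ) :
    LowerSemicontinuous fun f : C(UnitCube d, ℝ) => distFun α f := by
  refine lowerSemicontinuous_tsum fun k => ?_
  exact (continuous_const.min continuous_id).comp_lowerSemicontinuous
    (lowerSemicontinuous_oscNorm (d := d) _) (fun a b h => min_le_min le_rfl h)

/-- `C_α[0,1]^d`, the continuous functions whose graph has upper box dimension at most `α`,
as a linear subspace of `C[0,1]^d` (for `α ≥ d`). -/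
noncomputable def calphaSubmodule (d : ℕ) (α : ℝ) (hα : (d : ℝ) ≤ α) :
    Submodule ℝ C(UnitCube d, ℝ) where
  carrier := {f | upperBoxDim (graphSet f) ≤ (α : EReal)}
  add_mem' := by
    intro f g hf hg
    rw [Set.mem_ofPred_eq, upperBoxDim_le_iff hα] at *
    exact fun k => (oscNorm_add _ f g).trans_lt (ENNReal.add_lt_top.2 ⟨hf k, hg k⟩)
  zero_mem' := by
    rw [Set.mem_ofPred_eq, upperBoxDim_le_iff hα]
    simp [oscNorm_zero]
  smul_mem' := by
    intro c f hf
    rw [Set.mem_ofPred_eq, upperBoxDim_le_iff hα] at *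
    exact fun k => (oscNorm_smul _ c f).trans_lt (ENNReal.mul_lt_top ENNReal.ofReal_lt_top (hf k))

/-- The space `C_α[0,1]^d`. It is a separate type because it carries the metric `d_{α,d}`
and not the sup metric. -/
def CAlpha (d : ℕ) (α : ℝ) (hα : (d : ℝ) ≤ α) : Type := calphaSubmodule d α hα

namespace CAlpha

variable {d : ℕ} {α : ℝ} {hα : (d : ℝ) ≤ α}

noncomputable instance : AddCommGroup (CAlpha d α hα) :=
  inferInstanceAs (AddCommGroup (calphaSubmodule d α hα))

noncomputable instance : Module ℝ (CAlpha d α hα) :=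
  inferInstanceAs (Module ℝ (calphaSubmodule d α hα))

/-- The inclusion `C_α[0,1]^d → C[0,1]^d`. -/
noncomputable def toC : CAlpha d α hα →ₗ[ℝ] C(UnitCube d, ℝ) := (calphaSubmodule d α hα).subtype

theorem toC_injective : Function.Injective (toC : CAlpha d α hα → C(UnitCube d, ℝ)) :=
  Subtype.val_injective

theorem upperBoxDim_toC (f : CAlpha d α hα) : upperBoxDim (graphSet (toC f)) ≤ (α : EReal) :=
  Subtype.property f

theorem exists_toC_eq {g : C(UnitCube d, ℝ)} (h : upperBoxDim (graphSet g) ≤ (α : EReal)) :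
    ∃ f : CAlpha d α hα, toC f = g := ⟨⟨g, h⟩, rfl⟩

/-- The metric `d_{α,d}(f,g) = ∑_{k ≥ 1} min {2^(-k), ‖f - g‖_{α + 1/k, d}}`. -/
noncomputable instance : MetricSpace (CAlpha d α hα) :=
  letI : EMetricSpace (CAlpha d α hα) :=
    { edist := fun f g => distFun α (toC f - toC g)
      edist_self := fun f => by simp only [sub_self, distFun_zero]
      edist_comm := fun f g => by rw [← distFun_neg, neg_sub]
      edist_triangle := fun f g h => by
        rw [← sub_add_sub_cancel (toC f) (toC g) (toC h)]
        exact distFun_add _ _ _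
      eq_of_edist_eq_zero := fun {f g} h => by
        have h1 := oscNorm_le_of_distFun (k := 0) h.le (half_pow_pos _)
        have h2 := (norm_le_oscNorm _ _).trans h1
        rw [nonpos_iff_eq_zero, ENNReal.ofReal_eq_zero] at h2
        exact toC_injective (sub_eq_zero.1 (norm_le_zero_iff.1 h2)) }
  EMetricSpace.toMetricSpace fun f g => distFun_ne_top α (toC f - toC g)

theorem edist_eq (f g : CAlpha d α hα) : edist f g = distFun α (toC f - toC g) := rfl

theorem dist_eq (f g : CAlpha d α hα) : dist f g = (distFun α (toC f - toC g)).toReal := rfl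

instance : CompleteSpace (CAlpha d α hα) := by
  refine EMetric.complete_of_cauchySeq_tendsto fun u hu => ?_
  rw [EMetric.cauchySeq_iff] at hu
  have hc : CauchySeq fun n => toC (u n) := by
    rw [EMetric.cauchySeq_iff]
    intro ε hε
    obtain ⟨N, hN⟩ := hu (min ε ((2 : ℝ≥0∞)⁻¹ ^ (0 + 1))) (lt_min hε (half_pow_pos _))
    refine ⟨N, fun m hm n hn => ?_⟩
    have h1 := hN m hm n hn
    rw [edist_eq] at h1
    have h2 := oscNorm_le_of_distFun (k := 0) le_rfl (h1.trans_le (min_le_right _ _))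
    rw [edist_dist, dist_eq_norm]
    exact ((norm_le_oscNorm _ _).trans h2).trans_lt (h1.trans_le (min_le_left _ _))
  obtain ⟨g, hg⟩ := cauchySeq_tendsto_of_complete hc
  have key : ∀ ε > 0, ∃ N, ∀ n ≥ N, distFun α (toC (u n) - g) ≤ ε := by
    intro ε hε
    obtain ⟨N, hN⟩ := hu ε hε
    refine ⟨N, fun n hn => ?_⟩
    have hcl := (lowerSemicontinuous_distFun (d := d) α).isClosed_preimage ε
    refine hcl.mem_of_tendsto (tendsto_const_nhds.sub hg) ?_
    filter_upwards [eventually_ge_atTop N] with m hm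
    exact (hN n hn m hm).le
  have hmem : upperBoxDim (graphSet g) ≤ (α : EReal) := by
    rw [upperBoxDim_le_iff hα]
    intro k
    have hp : (0 : ℝ≥0∞) < (2 : ℝ≥0∞)⁻¹ ^ (k + 1) := half_pow_pos _
    obtain ⟨ε, hε0, hε⟩ := exists_between hp
    obtain ⟨N, hN⟩ := key ε hε0
    have h1 := oscNorm_le_of_distFun (hN N le_rfl) hε
    have h2 := (upperBoxDim_le_iff hα _).1 (upperBoxDim_toC (u N)) k
    have h3 := oscNorm_add (α + 1 / ((k : ℝ) + 1)) (-(toC (u N) - g)) (toC (u N))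
    rw [oscNorm_neg, neg_sub, sub_add_cancel] at h3
    exact h3.trans_lt (ENNReal.add_lt_top.2 ⟨h1.trans_lt (hε.trans_le le_top), h2⟩)
  obtain ⟨f, rfl⟩ := exists_toC_eq (hα := hα) hmem
  refine ⟨f, EMetric.tendsto_atTop.2 fun ε hε => ?_⟩
  obtain ⟨ε', h0, h1⟩ := exists_between hε
  obtain ⟨N, hN⟩ := key ε' h0
  exact ⟨N, fun n hn => (hN n hn).trans_lt h1⟩

instance : IsTopologicalAddGroup (CAlpha d α hα) where
  continuous_add := by
    refine LipschitzWith.continuous (K := 2) fun p q => ?_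
    rw [edist_eq, map_add, map_add, add_sub_add_comm]
    refine (distFun_add _ _ _).trans ?_
    rw [← edist_eq, ← edist_eq, ENNReal.coe_ofNat, two_mul, Prod.edist_eq]
    exact add_le_add (le_max_left _ _) (le_max_right _ _)
  continuous_neg := by
    refine LipschitzWith.continuous (K := 1) fun p q => ?_
    rw [edist_eq, edist_eq, map_neg, map_neg, ENNReal.coe_one, one_mul, ← distFun_neg]
    simp [sub_eq_add_neg, add_comm]

theorem edist_smul_zero_le (c : ℝ) (f : CAlpha d α hα) :
    edist (c • f) 0 ≤ max 1 (ENNReal.ofReal |c|) * edist f 0 := by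
  simpa [edist_eq] using distFun_smul α c (toC f)

instance : ContinuousSMul ℝ (CAlpha d α hα) := by
  refine ContinuousSMul.of_nhds_zero ?_ ?_ ?_
  · rw [tendsto_iff_edist_tendsto_0]
    have h1 : Tendsto (fun p : ℝ × CAlpha d α hα => edist p.2 0) (𝓝 0 ×ˢ 𝓝 0) (𝓝 0) :=
      (tendsto_iff_edist_tendsto_0.1 tendsto_id).comp tendsto_snd
    refine tendsto_of_tendsto_of_tendsto_of_le_of_le' tendsto_const_nhds h1
      (Eventually.of_forall fun _ => zero_le) ?_
    have h2 : ∀ᶠ c : ℝ in 𝓝 0, |c| ≤ 1 := by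
      have := Metric.closedBall_mem_nhds (0 : ℝ) one_pos
      filter_upwards [this] with c hc
      simpa using hc
    filter_upwards [tendsto_fst.eventually h2] with p hp
    have := edist_smul_zero_le p.1 p.2
    rwa [max_eq_left (ENNReal.ofReal_le_one.2 hp), one_mul] at this
  · intro f
    rw [tendsto_iff_edist_tendsto_0]
    have e : ∀ c : ℝ, edist (c • f) 0 = ∫⁻ k : ℕ, min ((2 : ℝ≥0∞)⁻¹ ^ (k + 1))
        (oscNorm (α + 1 / ((k : ℝ) + 1)) (c • toC f)) ∂MeasureTheory.Measure.count := by
      intro c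
      rw [MeasureTheory.lintegral_count, edist_eq, map_zero, sub_zero, map_smul, distFun]
    simp only [e]
    have h0 : (0 : ℝ≥0∞) = ∫⁻ _ : ℕ, 0 ∂MeasureTheory.Measure.count := by simp
    rw [h0]
    refine MeasureTheory.tendsto_lintegral_filter_of_dominated_convergence
      (fun k : ℕ => (2 : ℝ≥0∞)⁻¹ ^ (k + 1)) (Eventually.of_forall fun _ => measurable_from_nat)
      (Eventually.of_forall fun _ => Eventually.of_forall fun _ => min_le_left _ _) ?_ ?_
    · rw [MeasureTheory.lintegral_count, tsum_half_pow]; exact ENNReal.one_ne_top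
    · refine Eventually.of_forall fun k => ?_
      have hfin := (upperBoxDim_le_iff hα _).1 (upperBoxDim_toC f) k
      have h1 : Tendsto (fun c : ℝ => ENNReal.ofReal |c| *
          oscNorm (α + 1 / ((k : ℝ) + 1)) (toC f)) (𝓝 0) (𝓝 0) := by
        have h2 : Tendsto (fun c : ℝ => ENNReal.ofReal |c|) (𝓝 0) (𝓝 0) := by
          have := (ENNReal.continuous_ofReal.comp continuous_abs).tendsto (0 : ℝ)
          simpa [Function.comp_def] using this
        have := ENNReal.Tendsto.mul_const h2 (Or.inr hfin.ne)
        simpa using this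
      exact tendsto_of_tendsto_of_tendsto_of_le_of_le tendsto_const_nhds h1
        (fun _ => zero_le) (fun c => (min_le_right _ _).trans (oscNorm_smul _ c _))
  · intro c
    rw [tendsto_iff_edist_tendsto_0]
    have h1 : Tendsto (fun f : CAlpha d α hα => max 1 (ENNReal.ofReal |c|) * edist f 0)
        (𝓝 0) (𝓝 0) := by
      have h2 : Tendsto (fun f : CAlpha d α hα => edist f 0) (𝓝 0) (𝓝 0) :=
        tendsto_iff_edist_tendsto_0.1 tendsto_id
      have := ENNReal.Tendsto.const_mul (a := max 1 (ENNReal.ofReal |c|)) h2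
        (Or.inr (max_lt ENNReal.one_lt_top ENNReal.ofReal_lt_top).ne)
      simpa using this
    exact tendsto_of_tendsto_of_tendsto_of_le_of_le tendsto_const_nhds h1
        (fun _ => zero_le) (fun f => edist_smul_zero_le c f)

end CAlpha

/-! ### Prevalence -/

section Prevalence

variable {X : Type*} [AddCommGroup X] [Module ℝ X] [TopologicalSpace X]
  [IsTopologicalAddGroup X] [ContinuousSMul ℝ X] [TopologicalSpace.IsCompletelyMetrizableSpace X]

/-- Lebesgue measure of `S ∩ P`, in the coordinates that the basis `b` gives to the
`k`-dimensional subspace `P`; another basis only changes it by a positive factor. -/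
noncomputable def subspaceVolume {k : ℕ} {P : Submodule ℝ X} (b : Module.Basis (Fin k) ℝ P)
    (S : Set X) : ℝ≥0∞ :=
  MeasureTheory.volume {t : Fin k → ℝ | ∑ i, t i • (b i : X) ∈ S}

/-- The `k`-dimensional subspace `P`, with basis `b`, is a probe for `F`: Lebesgue measure on `P`
of the complement of every translate `F + x` is zero. -/
def IsProbe {k : ℕ} {P : Submodule ℝ X} (b : Module.Basis (Fin k) ℝ P) (F : Set X) : Prop :=
  ∀ x : X, subspaceVolume b ((fun y => y + x) '' F)ᶜ = 0

/-- A set `F` in a completely metrizable topological vector space is `k`-prevalent if it is a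
Borel set and some `k`-dimensional subspace is a probe for it. -/
def IsKPrevalent (k : ℕ) (F : Set X) : Prop :=
  @MeasurableSet X (borel X) F ∧
    ∃ (P : Submodule ℝ X) (b : Module.Basis (Fin k) ℝ P), IsProbe b F

end Prevalence

end GraphDim

namespace GraphDim

open Filter Topology
open scoped ENNReal

/-! ### Comparison of meshes -/

/-! The probe is the line spanned by one function `g`, a Takagi type series in a single coordinate
with parameter `s = α - d`. It oscillates strongly at every dyadic scale: its oscillation sum at
`2⁻ⁿ` is at least `2^(n(α-1)) / (2(n+1)²)` (`le_oscSum_takagiCube`). It is also Hölder with exponent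
`d + 1 - α`, so its graph has upper box dimension at most `α` (`upperBoxDim_takagiCube_le`). The
factor `(k+1)⁻²` makes the series converge at `s = 1` and preserves the exact Hölder exponent for
all `s ∈ [0,1]`, while costing only a polynomial factor in the lower bound.

Fix a translation `x`. Oscillation sums are subadditive and `(t - s) g = (t g - x) - (s g - x)`, so
the parameters `t` for which `t g - x` has oscillation sum below `2^(n(α-1-ε))` at scale `2⁻ⁿ` form
a set of diameter at most `4(n+1)² 2^(-nε)`. This is summable, and Borel–Cantelli
(`ae_eventually_le_oscSum`) shows that for almost every `t` the sum is eventually large. Mesh counts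
dominate oscillation sums divided by `δ`, hence the lower box dimension is at least `α`
(`ae_le_lowerBoxDim`).

The upper bound costs nothing: `t g - x` stays in the linear space `C_α`, and `d + 1` bounds the
upper box dimension of every graph. Borel measurability follows by reducing both dimension
conditions to countably many (`measurableSet_graphDimEq`). -/

/-- `Set.ncard` takes the value 0 on infinite sets; finiteness makes `meshCount` a genuine count. -/
theorem finite_meshCube_inter {ι : Type*} [Finite ι] {F : Set (ι → ℝ)}
    (hF : Bornology.IsBounded F) {δ : ℝ} (hδ : 0 < δ) :
    {m : ι → ℤ | (meshCube δ m ∩ F).Nonempty}.Finite := by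
  have := Fintype.ofFinite ι
  obtain ⟨R, hR⟩ := hF.exists_norm_le
  refine (Set.Finite.pi' (t := fun _ : ι => Set.Icc (⌈-R / δ⌉ - 1) ⌊R / δ⌋)
    fun _ => Set.finite_Icc _ _).subset ?_
  rintro m ⟨x, hm, hx⟩ i
  have h1 := abs_le.1 ((norm_le_pi_norm x i).trans (hR x hx))
  have h2 : (m i : ℝ) * δ ≤ x i := hm.1 i
  have h3 : x i ≤ ((m i : ℝ) + 1) * δ := hm.2 i
  simp only [Set.mem_Icc, Int.le_floor, sub_le_iff_le_add, Int.ceil_le, le_div_iff₀ hδ,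
    div_le_iff₀ hδ]
  push_cast
  constructor <;> linarith [h1.1, h1.2]

theorem exists_mem_meshCube {ι : Type*} {δ : ℝ} (hδ : 0 < δ) (x : ι → ℝ) :
    ∃ m : ι → ℤ, x ∈ meshCube δ m := by
  refine ⟨fun i => ⌊x i / δ⌋, fun i => ?_, fun i => ?_⟩
  · exact (le_div_iff₀ hδ).1 (Int.floor_le _)
  · exact (div_le_iff₀ hδ).1 (Int.lt_floor_add_one _).le

/-- Refining the mesh loses at most a constant factor in the number of cubes. -/
theorem meshCount_le_mul_meshCount {ι : Type*} [Fintype ι] {F : Set (ι → ℝ)}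
    (hF : Bornology.IsBounded F) {δ h : ℝ} (hδ : 0 < δ) (hδh : δ ≤ h) :
    meshCount F h ≤ 3 ^ Fintype.card ι * meshCount F δ := by
  classical
  have hh : 0 < h := hδ.trans_le hδh
  have f1 := finite_meshCube_inter hF hh
  have f2 := finite_meshCube_inter hF hδ
  have hex : ∀ m : ι → ℤ, (meshCube h m ∩ F).Nonempty →
      ∃ m' : ι → ℤ, (meshCube δ m' ∩ F).Nonempty ∧ (meshCube h m ∩ meshCube δ m').Nonempty := by
    rintro m ⟨x, hm, hx⟩
    obtain ⟨m', hm'⟩ := exists_mem_meshCube hδ x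
    exact ⟨m', ⟨x, hm', hx⟩, x, hm, hm'⟩
  choose! c hc1 hc2 using hex
  rw [meshCount, meshCount, Set.ncard_eq_toFinset_card _ f1, Set.ncard_eq_toFinset_card _ f2]
  refine Finset.card_le_mul_card_image_of_maps_to (f := c) ?_ _ ?_
  · intro m hm
    simp only [Set.Finite.mem_toFinset, Set.mem_ofPred_eq] at hm ⊢
    exact hc1 m hm
  · intro m' _
    -- Along each axis an interval of length `δ ≤ h` touches at most three consecutive mesh
    -- intervals of length `h`.
    have hsub : f1.toFinset.filter (fun m => c m = m') ⊆ Fintype.piFinset fun i =>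
        Finset.Icc (⌈(m' i : ℝ) * δ / h⌉ - 1) (⌈(m' i : ℝ) * δ / h⌉ + 1) := by
      intro m hm
      obtain ⟨hmF, rfl⟩ := Finset.mem_filter.1 hm
      obtain ⟨x, hx1, hx2⟩ := hc2 m (f1.mem_toFinset.1 hmF)
      rw [Fintype.mem_piFinset]
      intro i
      have a1 : (m i : ℝ) * h ≤ x i := hx1.1 i
      have a2 : x i ≤ ((m i : ℝ) + 1) * h := hx1.2 i
      have a3 : (c m i : ℝ) * δ ≤ x i := hx2.1 i
      have a4 : x i ≤ ((c m i : ℝ) + 1) * δ := hx2.2 i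
      rw [Finset.mem_Icc]
      constructor
      · rw [sub_le_iff_le_add, Int.ceil_le, div_le_iff₀ hh]
        push_cast
        linarith
      · have : (m i : ℝ) - 1 ≤ (c m i : ℝ) * δ / h := by
          rw [le_div_iff₀ hh]; linarith
        have := this.trans (Int.le_ceil _)
        have : m i - 1 ≤ ⌈(c m i : ℝ) * δ / h⌉ := by exact_mod_cast this
        linarith
    refine (Finset.card_le_card hsub).trans_eq ?_
    rw [Fintype.card_piFinset]
    have : ∀ z : ℤ, (Finset.Icc (z - 1) (z + 1)).card = 3 := by
      intro z; rw [Int.card_Icc]; omega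
    simp [this]

theorem isBounded_graphSet {d : ℕ} (f : C(UnitCube d, ℝ)) : Bornology.IsBounded (graphSet f) := by
  refine (isCompact_range ?_).isBounded
  refine continuous_pi fun i => ?_
  refine Fin.lastCases ?_ (fun i => ?_) i
  · simpa using f.continuous
  · simpa using! (continuous_apply i).comp continuous_subtype_val

/-- The lower box dimension is determined by the dyadic meshes. -/
theorem le_lowerBoxDim_iff {ι : Type*} [Fintype ι] {F : Set (ι → ℝ)}
    (hF : Bornology.IsBounded F) {α : ℝ} (hα : 1 ≤ α) :
    (α : EReal) ≤ lowerBoxDim F ↔ ∀ k : ℕ, ∀ᶠ n : ℕ in atTop,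
      (2 : ℝ) ^ ((n : ℝ) * (α - 1 / ((k : ℝ) + 1))) ≤ meshCount F ((2 : ℝ)⁻¹ ^ n) := by
  have hlog2 : 0 < Real.log 2 := Real.log_pos one_lt_two
  constructor
  · intro h k
    have hk0 : 0 < 1 / ((k : ℝ) + 1) := Nat.one_div_pos_of_nat
    have h1 : ((α - 1 / ((k : ℝ) + 1) : ℝ) : EReal) < lowerBoxDim F :=
      lt_of_lt_of_le (EReal.coe_lt_coe_iff.2 (by linarith)) h
    have h2 := eventually_lt_of_lt_liminf h1
    have ht : Tendsto (fun n : ℕ => (2 : ℝ)⁻¹ ^ n) atTop (𝓝[>] 0) :=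
      tendsto_nhdsWithin_iff.2 ⟨tendsto_pow_atTop_nhds_zero_of_lt_one (by norm_num) (by norm_num),
        Eventually.of_forall fun n => Set.mem_Ioi.2 (by positivity)⟩
    filter_upwards [ht.eventually h2, eventually_gt_atTop 0] with n hn hn0
    rw [EReal.coe_lt_coe_iff] at hn
    have hnpos : (0 : ℝ) < n := by exact_mod_cast hn0
    have hlog : -Real.log ((2 : ℝ)⁻¹ ^ n) = n * Real.log 2 := by
      rw [Real.log_pow, Real.log_inv]; ring
    rw [hlog, lt_div_iff₀ (by positivity)] at hn
    have hk1 : 1 / ((k : ℝ) + 1) ≤ 1 := by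
      rw [div_le_one (by positivity)]; linarith [Nat.cast_nonneg (α := ℝ) k]
    -- A zero count has `Real.log 0 = 0`, which cannot strictly exceed a nonnegative multiple of
    -- `log 2`; here `1 ≤ α` enters.
    have hN : (0 : ℝ) < meshCount F ((2 : ℝ)⁻¹ ^ n) := by
      rcases Nat.eq_zero_or_pos (meshCount F ((2 : ℝ)⁻¹ ^ n)) with h0 | h0
      · rw [h0, Nat.cast_zero, Real.log_zero] at hn
        exact absurd hn (not_lt.2 (by
          have : 0 ≤ α - 1 / ((k : ℝ) + 1) := by linarith
          positivity))
      · exact_mod_cast h0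
    rw [Real.rpow_le_iff_le_log two_pos hN]
    linarith
  · intro h
    have step : ∀ k : ℕ, ((α - 2 / ((k : ℝ) + 1) : ℝ) : EReal) ≤ lowerBoxDim F := by
      intro k
      have hk0 : 0 < 1 / ((k : ℝ) + 1) := Nat.one_div_pos_of_nat
      have hk1 : 1 / ((k : ℝ) + 1) ≤ 1 := by
        rw [div_le_one (by positivity)]; linarith [Nat.cast_nonneg (α := ℝ) k]
      have hsplit : α - 2 / ((k : ℝ) + 1) = α - 1 / ((k : ℝ) + 1) - 1 / ((k : ℝ) + 1) := by ring
      have hk := h k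
      rw [hsplit]
      set ε := 1 / ((k : ℝ) + 1)
      set β := α - ε with hβ
      have hβ0 : 0 ≤ β := by linarith
      obtain ⟨N, hN⟩ := eventually_atTop.1 hk
      -- Two losses: the factor `3^card ι` from changing mesh, and one dyadic step because `2⁻⁽ⁿ⁺¹⁾
      -- < δ ≤ 2⁻ⁿ`. Both are absorbed by the second `ε` once `-log δ ≥ C / ε`.
      set C : ℝ := Fintype.card ι * Real.log 3 + β * Real.log 2
      have hlim : Tendsto (fun δ : ℝ => -Real.log δ) (𝓝[>] 0) atTop :=
        tendsto_neg_atBot_atTop.comp Real.tendsto_log_nhdsGT_zero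
      refine le_liminf_of_le (h := ?_)
      filter_upwards [Ioo_mem_nhdsGT (show (0 : ℝ) < 2⁻¹ ^ N by positivity),
        hlim.eventually_ge_atTop (C / ε), Ioo_mem_nhdsGT (show (0 : ℝ) < 1 by norm_num)]
        with δ hδ hl hδ1
      rw [EReal.coe_le_coe_iff]
      have hlog : 0 < -Real.log δ := by linarith [Real.log_neg hδ1.1 hδ1.2]
      obtain ⟨n, hn1, hn2⟩ := exists_nat_pow_near_of_lt_one hδ.1 hδ1.2.le
        (show (0 : ℝ) < 2⁻¹ by norm_num) (by norm_num)
      have hNn : N ≤ n := by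
        by_contra hlt
        push Not at hlt
        have : (2 : ℝ)⁻¹ ^ N ≤ 2⁻¹ ^ (n + 1) :=
          pow_le_pow_of_le_one (by norm_num) (by norm_num) hlt
        linarith [hδ.2]
      have h1 := hN n hNn
      have h2 : (meshCount F ((2 : ℝ)⁻¹ ^ n) : ℝ) ≤
          3 ^ Fintype.card ι * (meshCount F δ : ℝ) := by
        exact_mod_cast meshCount_le_mul_meshCount hF hδ.1 hn2
      have h3 := h1.trans h2
      have hpos : (0 : ℝ) < 2 ^ ((n : ℝ) * β) := by positivity
      have hMpos : (0 : ℝ) < meshCount F δ := by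
        by_contra h0
        have : (meshCount F δ : ℝ) = 0 := le_antisymm (not_lt.1 h0) (Nat.cast_nonneg _)
        rw [this, mul_zero] at h3
        linarith
      have h4 := Real.log_le_log hpos h3
      rw [Real.log_rpow two_pos, Real.log_mul (by positivity) hMpos.ne', Real.log_pow] at h4
      have h5 := Real.log_le_log (by positivity) hn1.le
      rw [Real.log_pow, Real.log_inv] at h5
      push_cast at h5
      have h6 : β * (-Real.log δ) ≤ β * (n * Real.log 2 + Real.log 2) :=
        mul_le_mul_of_nonneg_left (by linarith) hβ0
      rw [div_le_iff₀ hk0] at hl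
      rw [le_div_iff₀ hlog]
      have h7 : C = Fintype.card ι * Real.log 3 + β * Real.log 2 := rfl
      linarith
    refine le_of_tendsto' (x := atTop) (f := fun k : ℕ =>
      ((α - 2 / ((k : ℝ) + 1) : ℝ) : EReal)) ?_ step
    refine (continuous_coe_real_ereal.tendsto α).comp ?_
    have := (tendsto_one_div_add_atTop_nhds_zero_nat (𝕜 := ℝ)).const_mul 2
    have := this.const_sub α
    simpa [div_eq_mul_inv] using this

/-! ### Upper bounds for the box dimension of graphs -/

theorem lowerBoxDim_le_upperBoxDim {ι : Type*} (F : Set (ι → ℝ)) :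
    lowerBoxDim F ≤ upperBoxDim F :=
  liminf_le_limsup

theorem mem_graphDimEq_iff {d : ℕ} {α : ℝ} {f : C(UnitCube d, ℝ)} :
    f ∈ graphDimEq d α ↔
      (α : EReal) ≤ lowerBoxDim (graphSet f) ∧ upperBoxDim (graphSet f) ≤ (α : EReal) := by
  have h := lowerBoxDim_le_upperBoxDim (graphSet f)
  exact ⟨fun hf => ⟨hf.1.ge, hf.2.le⟩,
    fun hf => ⟨le_antisymm (h.trans hf.2) hf.1, le_antisymm hf.2 (hf.1.trans h)⟩⟩

/-- A uniform bound on the oscillations over mesh cubes bounds the upper box dimension. -/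
theorem upperBoxDim_le_of_osc_le {d : ℕ} {α : ℝ} (hα : (d : ℝ) ≤ α) {f : C(UnitCube d, ℝ)}
    {C : ℝ} (hC : 0 ≤ C) (h : ∀ δ ∈ Set.Ioc (0 : ℝ) 1, ∀ p : Fin d → ℤ,
      osc f (meshCube δ p) ≤ ENNReal.ofReal (C * δ ^ ((d : ℝ) + 1 - α))) :
    upperBoxDim (graphSet f) ≤ (α : EReal) := by
  rw [upperBoxDim_le_iff hα]
  intro k
  have hk0 : 0 < 1 / ((k : ℝ) + 1) := Nat.one_div_pos_of_nat
  set ε := 1 / ((k : ℝ) + 1)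
  refine ENNReal.add_lt_top.2 ⟨ENNReal.ofReal_lt_top, ?_⟩
  -- There are `⌈δ⁻¹⌉ᵈ ≤ (2/δ)ᵈ` cubes, so the oscillation sum is at most `2ᵈ C δ^(1-α)`.
  refine lt_of_le_of_lt (iSup₂_le fun δ hδ => ?_)
    (ENNReal.ofReal_lt_top (r := 2 ^ d * C))
  refine ENNReal.div_le_of_le_mul ?_
  refine (Finset.sum_le_sum fun n _ => h δ hδ _).trans ?_
  have hδ0 := hδ.1
  rw [Finset.sum_const, nsmul_eq_mul, ← ENNReal.ofReal_natCast, ← ENNReal.ofReal_mul (by positivity),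
    ← ENNReal.ofReal_mul (by positivity)]
  refine ENNReal.ofReal_le_ofReal ?_
  simp only [Finset.card_univ, Fintype.card_pi, Fintype.card_fin, Finset.prod_const]
  push_cast
  have hceil : (⌈δ⁻¹⌉₊ : ℝ) ≤ 2 * δ⁻¹ := by
    have h6 := (Nat.ceil_lt_add_one (inv_pos.2 hδ0).le).le
    have h7 : 1 ≤ δ⁻¹ := (one_le_inv₀ hδ0).2 hδ.2
    linarith
  calc (⌈δ⁻¹⌉₊ : ℝ) ^ d * (C * δ ^ ((d : ℝ) + 1 - α))
      ≤ (2 * δ⁻¹) ^ d * (C * δ ^ ((d : ℝ) + 1 - α)) := by gcongr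
    _ = 2 ^ d * C * (δ ^ (-(d : ℝ)) * δ ^ ((d : ℝ) + 1 - α)) := by
      rw [mul_pow, inv_pow, Real.rpow_neg hδ0.le, Real.rpow_natCast]; ring
    _ = 2 ^ d * C * δ ^ (1 - α) := by rw [← Real.rpow_add hδ0]; ring_nf
    _ ≤ 2 ^ d * C * δ ^ (1 - (α + ε)) := by
      gcongr ?_ * ?_
      exact Real.rpow_le_rpow_of_exponent_ge hδ0 hδ.2 (by linarith)

/-- For `α = d + 1` the exponent in `upperBoxDim_le_of_osc_le` vanishes, and the trivial oscillation
bound `2‖f‖` is enough. -/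
theorem upperBoxDim_graphSet_le {d : ℕ} (f : C(UnitCube d, ℝ)) :
    upperBoxDim (graphSet f) ≤ (((d : ℝ) + 1 : ℝ) : EReal) :=
  upperBoxDim_le_of_osc_le (C := 2 * ‖f‖) (by linarith) (by positivity)
    fun δ _ p => by simpa using osc_le_norm f _

/-! ### Measurability -/

/-- The set is the projection, along the compact unit cube, of the closed set of pairs `(f, x)` with
`(x, f x)` in the mesh cube. -/
theorem isClosed_setOf_meshCube_inter_graphSet {d : ℕ} (δ : ℝ) (m : Fin (d + 1) → ℤ) :
    IsClosed {f : C(UnitCube d, ℝ) | (meshCube δ m ∩ graphSet f).Nonempty} := by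
  have hc : Continuous fun p : C(UnitCube d, ℝ) × UnitCube d =>
      (Fin.snoc (p.2 : Fin d → ℝ) (p.1 p.2) : Fin (d + 1) → ℝ) := by
    refine continuous_pi fun i => ?_
    refine Fin.lastCases ?_ (fun i => ?_) i
    · simpa using continuous_eval
    · simpa using! (continuous_apply i).comp (continuous_subtype_val.comp continuous_snd)
  have h1 := isClosedMap_fst_of_compactSpace _
    ((isClosed_Icc (a := fun i => (m i : ℝ) * δ) (b := fun i => ((m i : ℝ) + 1) * δ)).preimage hc)
  convert h1 using 1
  ext f
  constructor
  · rintro ⟨_, hm, x, rfl⟩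
    exact ⟨(f, x), hm, rfl⟩
  · rintro ⟨⟨f, x⟩, hm, rfl⟩
    exact ⟨_, hm, x, rfl⟩

/-- The count reaches `c` exactly when all cubes of some finite family with at least `c` members
meet the graph. There are countably many such families, and each gives a closed condition. -/
theorem measurableSet_le_meshCount {d : ℕ} {δ : ℝ} (hδ : 0 < δ) (c : ℝ) :
    @MeasurableSet _ (borel C(UnitCube d, ℝ)) {f | c ≤ meshCount (graphSet f) δ} := by
  let _ : MeasurableSpace C(UnitCube d, ℝ) := borel _
  have : BorelSpace C(UnitCube d, ℝ) := ⟨rfl⟩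
  have e : {f : C(UnitCube d, ℝ) | c ≤ meshCount (graphSet f) δ} =
      ⋃ s : {s : Finset (Fin (d + 1) → ℤ) // c ≤ s.card}, ⋂ m ∈ s.1,
        {f | (meshCube δ m ∩ graphSet f).Nonempty} := by
    ext f
    have hfin := finite_meshCube_inter (isBounded_graphSet f) hδ
    simp only [Set.mem_iUnion, Set.mem_iInter, Set.mem_ofPred_eq]
    constructor
    · intro h
      rw [meshCount, Set.ncard_eq_toFinset_card _ hfin] at h
      exact ⟨⟨hfin.toFinset, h⟩, fun m hm => by simpa using hm⟩
    · rintro ⟨s, hs⟩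
      refine s.2.trans ?_
      rw [meshCount, Nat.cast_le, ← Set.ncard_coe_finset]
      exact Set.ncard_le_ncard (fun m hm => hs m hm) hfin
  rw [e]
  exact MeasurableSet.iUnion fun s => Finset.measurableSet_biInter _ fun m _ =>
    (isClosed_setOf_meshCube_inter_graphSet δ m).measurableSet

/-- The uncountable range of `δ` is removed in two ways: dyadic scales suffice for the lower
dimension, and the supremum in `oscNorm` is lower semicontinuous in `f`. -/
theorem measurableSet_graphDimEq {d : ℕ} (hd : 1 ≤ d) {α : ℝ} (hα : (d : ℝ) ≤ α) :
    @MeasurableSet _ (borel C(UnitCube d, ℝ)) (graphDimEq d α) := by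
  let _ : MeasurableSpace C(UnitCube d, ℝ) := borel _
  have : BorelSpace C(UnitCube d, ℝ) := ⟨rfl⟩
  have hα1 : 1 ≤ α := le_trans (by exact_mod_cast hd) hα
  have e : graphDimEq d α = {f | ∀ k : ℕ, ∀ᶠ n : ℕ in atTop,
      (2 : ℝ) ^ ((n : ℝ) * (α - 1 / ((k : ℝ) + 1))) ≤
        meshCount (graphSet f) ((2 : ℝ)⁻¹ ^ n)} ∩
      {f | ∀ k : ℕ, oscNorm (α + 1 / ((k : ℝ) + 1)) f < ∞} := by
    ext f
    rw [mem_graphDimEq_iff, le_lowerBoxDim_iff (isBounded_graphSet f) hα1, upperBoxDim_le_iff hα]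
    rfl
  rw [e]
  refine MeasurableSet.inter ?_ ?_
  · simp only [eventually_atTop, Set.ofPred_forall, Set.ofPred_exists]
    refine MeasurableSet.iInter fun k => MeasurableSet.iUnion fun N =>
      MeasurableSet.iInter fun n => MeasurableSet.iInter fun _ =>
      measurableSet_le_meshCount (by positivity) _
  · rw [Set.ofPred_forall]
    exact MeasurableSet.iInter fun k =>
      (lowerSemicontinuous_oscNorm _).measurable measurableSet_Iio

/-! ### Functions of Takagi type -/

/-- The coefficients `2^(-k(1-s)) / (k+1)^2` of the Takagi type series. -/
noncomputable def takagiCoeff (s : ℝ) (k : ℕ) : ℝ := ((2 : ℝ) ^ k) ^ (s - 1) / ((k : ℝ) + 1) ^ 2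

/-- The Takagi type function `∑ k, 2^(-k(1-s)) (k+1)^(-2) ‖2^k x‖`, where `‖y‖` is the distance
from `y` to the nearest integer. -/
noncomputable def takagi (s x : ℝ) : ℝ :=
  ∑' k : ℕ, takagiCoeff s k * ‖((2 ^ k * x : ℝ) : UnitAddCircle)‖

theorem takagiCoeff_pos (s : ℝ) (k : ℕ) : 0 < takagiCoeff s k := by
  unfold takagiCoeff; positivity

theorem takagiCoeff_le {s : ℝ} (hs : s ≤ 1) (k : ℕ) :
    takagiCoeff s k ≤ 1 / ((k : ℝ) + 1) ^ 2 := by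
  unfold takagiCoeff
  gcongr
  exact Real.rpow_le_one_of_one_le_of_nonpos (one_le_pow₀ one_le_two) (by linarith)

theorem summable_one_div_add_one_sq : Summable fun k : ℕ => 1 / ((k : ℝ) + 1) ^ 2 := by
  have := (summable_nat_add_iff 1).2 (Real.summable_one_div_nat_pow.2 one_lt_two)
  simpa using this

theorem norm_unitAddCircle_le (y : UnitAddCircle) : ‖y‖ ≤ 1 / 2 := by
  simpa using AddCircle.norm_le_half_period (1 : ℝ) (x := y) one_ne_zero

theorem takagi_term_le {s : ℝ} (hs : s ≤ 1) (x : ℝ) (k : ℕ) :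
    ‖takagiCoeff s k * ‖((2 ^ k * x : ℝ) : UnitAddCircle)‖‖ ≤ 1 / ((k : ℝ) + 1) ^ 2 := by
  rw [norm_mul, norm_norm, Real.norm_of_nonneg (takagiCoeff_pos s k).le]
  calc _ ≤ 1 / ((k : ℝ) + 1) ^ 2 * 1 :=
        mul_le_mul (takagiCoeff_le hs k) ((norm_unitAddCircle_le _).trans (by norm_num))
          (norm_nonneg _) (by positivity)
    _ = _ := mul_one _

theorem summable_takagi {s : ℝ} (hs : s ≤ 1) (x : ℝ) :
    Summable fun k : ℕ => takagiCoeff s k * ‖((2 ^ k * x : ℝ) : UnitAddCircle)‖ :=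
  .of_norm_bounded summable_one_div_add_one_sq (takagi_term_le hs x)

theorem continuous_takagi {s : ℝ} (hs : s ≤ 1) : Continuous (takagi s) := by
  refine continuous_tsum (fun k => ?_) summable_one_div_add_one_sq
    fun k x => takagi_term_le hs x k
  exact continuous_const.mul
    ((AddCircle.continuous_mk' 1).comp (continuous_const.mul continuous_id)).norm

/-- Interpolates between a bounded and a Lipschitz estimate to give a Hölder one. -/
theorem min_one_le_rpow {r θ : ℝ} (hr : 0 ≤ r) (h0 : 0 ≤ θ) (h1 : θ ≤ 1) : min 1 r ≤ r ^ θ := by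
  rcases le_total r 1 with h | h
  · exact (min_le_right _ _).trans (Real.self_le_rpow_of_le_one hr h h1)
  · exact (min_le_left _ _).trans (Real.one_le_rpow h h0)

/-- The Takagi type function is Hölder continuous with exponent `1 - s`. -/
theorem abs_takagi_sub_le {s : ℝ} (h0 : 0 ≤ s) (h1 : s ≤ 1) (x y : ℝ) :
    |takagi s x - takagi s y| ≤ (∑' k : ℕ, 1 / ((k : ℝ) + 1) ^ 2) * |x - y| ^ (1 - s) := by
  rw [takagi, takagi, ← (summable_takagi h1 x).tsum_sub (summable_takagi h1 y), ← Real.norm_eq_abs,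
    ← tsum_mul_right]
  refine tsum_of_norm_bounded
    (summable_one_div_add_one_sq.mul_right (|x - y| ^ (1 - s))).hasSum fun k => ?_
  have hp : (0 : ℝ) < 2 ^ k := by positivity
  have hlip : |‖((2 ^ k * x : ℝ) : UnitAddCircle)‖ - ‖((2 ^ k * y : ℝ) : UnitAddCircle)‖| ≤
      2 ^ k * |x - y| := by
    refine (abs_norm_sub_norm_le _ _).trans ?_
    rw [← AddCircle.coe_sub, ← mul_sub]
    rw [UnitAddCircle.norm_eq]
    refine (round_le _ 0).trans_eq ?_
    rw [Int.cast_zero, sub_zero, abs_mul, abs_of_pos hp]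
  have hone : |‖((2 ^ k * x : ℝ) : UnitAddCircle)‖ - ‖((2 ^ k * y : ℝ) : UnitAddCircle)‖| ≤ 1 := by
    have a1 := norm_unitAddCircle_le ((2 ^ k * x : ℝ) : UnitAddCircle)
    have a2 := norm_unitAddCircle_le ((2 ^ k * y : ℝ) : UnitAddCircle)
    have a3 := norm_nonneg ((2 ^ k * x : ℝ) : UnitAddCircle)
    have a4 := norm_nonneg ((2 ^ k * y : ℝ) : UnitAddCircle)
    rw [abs_le]
    constructor <;> linarith
  -- The resulting factor `2^(k(1-s))` cancels against the coefficient and leaves the summable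
  -- `(k+1)⁻²`.
  have hmin := (le_min hone hlip).trans
    (min_one_le_rpow (θ := 1 - s) (by positivity) (by linarith) (by linarith))
  rw [← mul_sub, norm_mul, Real.norm_of_nonneg (takagiCoeff_pos s k).le, Real.norm_eq_abs]
  refine (mul_le_mul_of_nonneg_left hmin (takagiCoeff_pos s k).le).trans_eq ?_
  have : ((2 : ℝ) ^ k) ^ (s - 1) * ((2 : ℝ) ^ k) ^ (1 - s) = 1 := by
    rw [← Real.rpow_add hp]; simp
  rw [Real.mul_rpow hp.le (abs_nonneg _), takagiCoeff]
  calc _ = (((2 : ℝ) ^ k) ^ (s - 1) * ((2 : ℝ) ^ k) ^ (1 - s)) / ((k : ℝ) + 1) ^ 2 *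
        |x - y| ^ (1 - s) := by ring
    _ = _ := by rw [this]

/-- The distance to the nearest integer is affine between consecutive half integers. -/
theorem norm_add_norm_eq_of_mem_Icc {q : ℤ} {x y : ℝ}
    (hx : x ∈ Set.Icc ((q : ℝ) / 2) (((q : ℝ) + 1) / 2))
    (hy : y ∈ Set.Icc ((q : ℝ) / 2) (((q : ℝ) + 1) / 2)) :
    ‖(x : UnitAddCircle)‖ + ‖(y : UnitAddCircle)‖ =
      2 * ‖(((x + y) / 2 : ℝ) : UnitAddCircle)‖ := by
  have hper : ∀ (z : ℝ) (r : ℤ), |z - r| ≤ 1 / 2 → ‖(z : UnitAddCircle)‖ = |z - r| := by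
    intro z r hz
    have hr : ((r : ℝ) : UnitAddCircle) = 0 := (AddCircle.coe_eq_zero_iff 1).2 ⟨r, by simp⟩
    have e : (z : UnitAddCircle) = ((z - r : ℝ) : UnitAddCircle) := by
      rw [AddCircle.coe_sub, hr, sub_zero]
    rw [e, AddCircle.norm_coe_eq_abs_iff 1 one_ne_zero]
    simpa using hz
  have hm : (x + y) / 2 ∈ Set.Icc ((q : ℝ) / 2) (((q : ℝ) + 1) / 2) :=
    ⟨by linarith [hx.1, hy.1], by linarith [hx.2, hy.2]⟩
  -- For `q = 2r` the interval is `[r, r + 1/2]`, with nearest integer `r`; for `q = 2r + 1` it is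
  -- `[r + 1/2, r + 1]`, with nearest integer `r + 1`.
  obtain ⟨r, hr | hr⟩ := q.even_or_odd'
  · have h : ∀ z ∈ Set.Icc ((q : ℝ) / 2) (((q : ℝ) + 1) / 2), ‖(z : UnitAddCircle)‖ = z - r := by
      rintro z ⟨z1, z2⟩
      rw [hr] at z1 z2
      push_cast at z1 z2
      have : |z - r| = z - r := abs_of_nonneg (by linarith)
      rw [hper z r (by rw [this]; linarith), this]
    rw [h x hx, h y hy, h _ hm]
    ring
  · have h : ∀ z ∈ Set.Icc ((q : ℝ) / 2) (((q : ℝ) + 1) / 2),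
        ‖(z : UnitAddCircle)‖ = r + 1 - z := by
      rintro z ⟨z1, z2⟩
      rw [hr] at z1 z2
      push_cast at z1 z2
      have : |z - (r + 1 : ℤ)| = r + 1 - z := by
        push_cast
        rw [abs_of_nonpos (by linarith)]
        ring
      rw [hper z (r + 1) (by rw [this]; linarith), this]
    rw [h x hx, h y hy, h _ hm]
    ring

/-- The second difference of the Takagi type function over a dyadic interval is one of the
coefficients of the series. -/
theorem takagi_second_difference {s : ℝ} (hs : s ≤ 1) (n : ℕ) (j : ℤ) :
    takagi s ((j : ℝ) * 2⁻¹ ^ n) + takagi s (((j : ℝ) + 1) * 2⁻¹ ^ n) -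
      2 * takagi s (((j : ℝ) + 1 / 2) * 2⁻¹ ^ n) = -takagiCoeff s n := by
  have hint : ∀ z : ℤ, ‖((z : ℝ) : UnitAddCircle)‖ = 0 := fun z => by simp
  rw [takagi, takagi, takagi, ← tsum_mul_left,
    ← (summable_takagi hs _).tsum_add (summable_takagi hs _),
    ← ((summable_takagi hs _).add (summable_takagi hs _)).tsum_sub
      ((summable_takagi hs _).mul_left 2), tsum_eq_single n]
  -- Term `k = n`: the endpoints scale to integers and the midpoint to a half integer, at distance
  -- `1/2`.
  · have e : ∀ z : ℝ, 2 ^ n * (z * 2⁻¹ ^ n) = z := by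
      intro z
      rw [mul_comm z, ← mul_assoc, ← mul_pow]
      norm_num
    have e1 : ‖(((j : ℝ) + 1 : ℝ) : UnitAddCircle)‖ = 0 := by simp
    have e2 : ‖(((j : ℝ) + 1 / 2 : ℝ) : UnitAddCircle)‖ = 1 / 2 := by
      have : (((j : ℝ) + 1 / 2 : ℝ) : UnitAddCircle) = ((1 / 2 : ℝ) : UnitAddCircle) := by simp
      rw [this, (AddCircle.norm_coe_eq_abs_iff 1 one_ne_zero).2 (by norm_num)]
      norm_num
    rw [e, e, e, hint, e1, e2]
    ring
  · intro k hk
    rcases lt_or_gt_of_ne hk with hlt | hgt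
    -- Terms `k < n`: the scaled interval lies between the consecutive half integers `q/2` and
    -- `(q+1)/2`, where the distance is affine, so the second difference vanishes.
    · obtain ⟨i, rfl⟩ : ∃ i, n = k + (i + 1) := ⟨n - k - 1, by omega⟩
      have e : ∀ z : ℝ, 2 ^ k * (z * 2⁻¹ ^ (k + (i + 1))) = z / 2 ^ i / 2 := by
        intro z
        rw [inv_pow, pow_add, pow_succ]
        field_simp
      have hp : (0 : ℝ) < 2 ^ i := by positivity
      have hpz : (0 : ℤ) < 2 ^ i := by positivity
      set q : ℤ := j / 2 ^ i
      have q1 : (q : ℝ) * 2 ^ i ≤ j := by exact_mod_cast Int.ediv_mul_le j hpz.ne'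
      -- The gain of one comes from the strict inequality `j < (q + 1) * 2 ^ i` between integers.
      have q2 : (j : ℝ) + 1 ≤ (q + 1) * 2 ^ i := by
        exact_mod_cast Int.lt_ediv_add_one_mul_self j hpz
      have key := norm_add_norm_eq_of_mem_Icc (q := q) (x := (j : ℝ) / 2 ^ i / 2)
        (y := ((j : ℝ) + 1) / 2 ^ i / 2)
        ⟨by gcongr; rwa [le_div_iff₀ hp], by gcongr; rw [div_le_iff₀ hp]; linarith⟩
        ⟨by gcongr; rw [le_div_iff₀ hp]; linarith, by gcongr; rwa [div_le_iff₀ hp]⟩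
      have hmid : ((j : ℝ) / 2 ^ i / 2 + ((j : ℝ) + 1) / 2 ^ i / 2) / 2 =
          ((j : ℝ) + 1 / 2) / 2 ^ i / 2 := by ring
      rw [hmid] at key
      rw [e, e, e, ← mul_add, key]
      ring
    -- Terms `k > n`: all three points, the midpoint included, scale to integers.
    · obtain ⟨i, rfl⟩ : ∃ i, k = n + (i + 1) := ⟨k - n - 1, by omega⟩
      have e : ∀ z : ℝ, 2 ^ (n + (i + 1)) * (z * 2⁻¹ ^ n) = 2 ^ (i + 1) * z := by
        intro z
        rw [inv_pow, pow_add]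
        field_simp
      have e1 : ((2 : ℝ) ^ (i + 1) * j) = ((2 ^ (i + 1) * j : ℤ) : ℝ) := by push_cast; ring
      have e2 : ((2 : ℝ) ^ (i + 1) * (j + 1)) = ((2 ^ (i + 1) * (j + 1) : ℤ) : ℝ) := by
        push_cast; ring
      have e3 : ((2 : ℝ) ^ (i + 1) * (j + 1 / 2)) = ((2 ^ i * (2 * j + 1) : ℤ) : ℝ) := by
        push_cast; ring
      rw [e, e, e, e1, e2, e3, hint, hint, hint]
      ring

/-- The function `x ↦ takagi s (x i)` on the unit cube. -/
noncomputable def takagiCube {d : ℕ} (i : Fin d) {s : ℝ} (hs : s ≤ 1) : C(UnitCube d, ℝ) :=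
  ⟨fun x => takagi s (x.1 i),
    (continuous_takagi hs).comp ((continuous_apply i).comp continuous_subtype_val)⟩

theorem upperBoxDim_takagiCube_le {d : ℕ} (i : Fin d) {α : ℝ} (hα : (d : ℝ) ≤ α)
    (hs : α - d ≤ 1) : upperBoxDim (graphSet (takagiCube i hs)) ≤ (α : EReal) := by
  have hC : 0 ≤ ∑' k : ℕ, 1 / ((k : ℝ) + 1) ^ 2 := tsum_nonneg fun k => by positivity
  refine upperBoxDim_le_of_osc_le hα hC fun δ hδ p => osc_le_iff.2 fun x y hx hy => ?_
  refine ENNReal.ofReal_le_ofReal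
    ((abs_takagi_sub_le (s := α - d) (by linarith) hs (x.1 i) (y.1 i)).trans ?_)
  rw [show 1 - (α - d) = (d : ℝ) + 1 - α by ring]
  refine mul_le_mul_of_nonneg_left (Real.rpow_le_rpow (abs_nonneg _) ?_ (by linarith)) hC
  have x1 : (p i : ℝ) * δ ≤ x.1 i := hx.1 i
  have x2 : x.1 i ≤ ((p i : ℝ) + 1) * δ := hx.2 i
  have y1 : (p i : ℝ) * δ ≤ y.1 i := hy.1 i
  have y2 : y.1 i ≤ ((p i : ℝ) + 1) * δ := hy.2 i
  rw [abs_le]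
  constructor <;> linarith

/-- By `takagi_second_difference`, the function oscillates by at least half the `n`-th coefficient
on every dyadic cube. Multiplying by the `2^(nd)` cubes gives the exponent `n(α - 1)`. -/
theorem le_oscSum_takagiCube {d : ℕ} (i : Fin d) {α : ℝ} (hs : α - d ≤ 1) (n : ℕ) :
    ENNReal.ofReal ((2 : ℝ) ^ ((n : ℝ) * (α - 1)) / (2 * ((n : ℝ) + 1) ^ 2)) ≤
      oscSum (takagiCube i hs) ((2 : ℝ)⁻¹ ^ n) := by
  have hδ : (0 : ℝ) < 2⁻¹ ^ n := by positivity
  have hceil : ⌈((2 : ℝ)⁻¹ ^ n)⁻¹⌉₊ = 2 ^ n := by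
    rw [← inv_pow, inv_inv]
    exact_mod_cast Nat.ceil_natCast (R := ℝ) (2 ^ n)
  have hcube : ∀ m : Fin d → Fin ⌈((2 : ℝ)⁻¹ ^ n)⁻¹⌉₊,
      ENNReal.ofReal (takagiCoeff (α - d) n / 2) ≤
        osc (takagiCube i hs) (meshCube ((2 : ℝ)⁻¹ ^ n) fun l => ((m l : ℕ) : ℤ)) := by
    intro m
    have hm : ∀ l, ((m l : ℕ) : ℝ) + 1 ≤ 2 ^ n := by
      intro l
      have := (m l).2.trans_eq hceil
      exact_mod_cast this
    -- The test points lie on the diagonal of the cube; only their `i`-th coordinate affects the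
    -- value.
    have hpt : ∀ c ∈ Set.Icc (0 : ℝ) 1, ∃ x : UnitCube d,
        (x : Fin d → ℝ) ∈ meshCube ((2 : ℝ)⁻¹ ^ n) (fun l => ((m l : ℕ) : ℤ)) ∧
        takagiCube i hs x = takagi (α - d) (((m i : ℕ) + c) * 2⁻¹ ^ n) := by
      intro c hc
      refine ⟨⟨fun l => ((m l : ℕ) + c) * 2⁻¹ ^ n, fun l => ?_, fun l => ?_⟩,
        ⟨fun l => ?_, fun l => ?_⟩, rfl⟩
      · have := hc.1
        simp only [Pi.zero_apply]
        positivity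
      · simp only [Pi.one_apply]
        calc (((m l : ℕ) : ℝ) + c) * 2⁻¹ ^ n ≤ 2 ^ n * 2⁻¹ ^ n := by
              gcongr
              linarith [hm l, hc.2]
          _ = 1 := by rw [← mul_pow]; norm_num
      · simp only [Int.cast_natCast]
        gcongr
        linarith [hc.1]
      · simp only [Int.cast_natCast]
        gcongr
        exact hc.2
    obtain ⟨u, hu, eu⟩ := hpt 0 (by simp)
    obtain ⟨v, hv, ev⟩ := hpt 1 (by simp)
    obtain ⟨w, hw, ew⟩ := hpt (1 / 2) (by constructor <;> norm_num)
    have h2 := takagi_second_difference hs n ((m i : ℕ) : ℤ)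
    rw [Int.cast_natCast, ← ev, ← ew] at h2
    rw [add_zero] at eu
    rw [← eu] at h2
    have o1 := osc_le_iff.1 (le_refl (osc (takagiCube i hs) _)) w u hw hu
    have o2 := osc_le_iff.1 (le_refl (osc (takagiCube i hs) _)) w v hw hv
    have a1 := le_abs_self (takagiCube i hs w - takagiCube i hs u)
    have a2 := le_abs_self (takagiCube i hs w - takagiCube i hs v)
    -- The increments from `u` to `w` and from `v` to `w` add up to the coefficient, so one of them
    -- is at least half of it.
    rcases le_total (takagiCoeff (α - d) n / 2) (takagiCube i hs w - takagiCube i hs u) with h | h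
    · exact (ENNReal.ofReal_le_ofReal (h.trans a1)).trans o1
    · exact (ENNReal.ofReal_le_ofReal (le_trans (by linarith) a2)).trans o2
  refine le_trans ?_ (Finset.sum_le_sum fun m _ => hcube m)
  rw [Finset.sum_const, nsmul_eq_mul, ← ENNReal.ofReal_natCast, ← ENNReal.ofReal_mul (by positivity)]
  simp only [Finset.card_univ, Fintype.card_pi, Fintype.card_fin, Finset.prod_const, hceil]
  refine ENNReal.ofReal_le_ofReal (le_of_eq ?_)
  have : (2 : ℝ) ^ ((n : ℝ) * (α - 1)) = ((2 : ℝ) ^ n) ^ d * ((2 : ℝ) ^ n) ^ (α - d - 1) := by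
    rw [← Real.rpow_natCast _ d, ← Real.rpow_add (by positivity), ← Real.rpow_natCast,
      ← Real.rpow_mul two_pos.le]
    ring_nf
  rw [this, takagiCoeff]
  push_cast
  field_simp

/-! ### Prevalence -/

/-- Two multiples of a function cannot both have small oscillations after the same translation. -/
theorem ofReal_abs_sub_mul_oscSum_le {d : ℕ} (g x : C(UnitCube d, ℝ)) (δ t s : ℝ) :
    ENNReal.ofReal |t - s| * oscSum g δ ≤ oscSum (t • g - x) δ + oscSum (s • g - x) δ := by
  rcases eq_or_ne t s with rfl | hts
  · simp
  have hne : t - s ≠ 0 := sub_ne_zero.2 hts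
  have hpos : 0 < |t - s| := abs_pos.2 hne
  -- The translation `x` cancels in the difference.
  have e : g = (t - s)⁻¹ • ((t • g - x) + (-1 : ℝ) • (s • g - x)) := by
    have : (t • g - x) + (-1 : ℝ) • (s • g - x) = (t - s) • g := by module
    rw [this, smul_smul, inv_mul_cancel₀ hne, one_smul]
  have h1 : oscSum ((-1 : ℝ) • (s • g - x)) δ ≤ oscSum (s • g - x) δ := by
    simpa using oscSum_smul (-1) (s • g - x) δ
  calc ENNReal.ofReal |t - s| * oscSum g δ
      ≤ ENNReal.ofReal |t - s| * (ENNReal.ofReal |(t - s)⁻¹| *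
          oscSum ((t • g - x) + (-1 : ℝ) • (s • g - x)) δ) := by
        gcongr
        conv_lhs => rw [e]
        exact oscSum_smul _ _ _
    _ = oscSum ((t • g - x) + (-1 : ℝ) • (s • g - x)) δ := by
        rw [← mul_assoc, ← ENNReal.ofReal_mul hpos.le, abs_inv, mul_inv_cancel₀ hpos.ne',
          ENNReal.ofReal_one, one_mul]
    _ ≤ _ := (oscSum_add _ _ _).trans (add_le_add le_rfl h1)

/-- Borel–Cantelli for the sets `A n` of bad parameters: two bad parameters at the same scale must
be close, since otherwise `g` itself would have a small oscillation sum there. -/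
theorem ae_eventually_le_oscSum {d : ℕ} {α ε : ℝ} (hε : 0 < ε) {g : C(UnitCube d, ℝ)}
    (hg : ∀ n : ℕ, ENNReal.ofReal ((2 : ℝ) ^ ((n : ℝ) * (α - 1)) / (2 * ((n : ℝ) + 1) ^ 2)) ≤
      oscSum g ((2 : ℝ)⁻¹ ^ n)) (x : C(UnitCube d, ℝ)) :
    ∀ᵐ t : ℝ, ∀ᶠ n : ℕ in atTop, ENNReal.ofReal ((2 : ℝ) ^ ((n : ℝ) * (α - 1 - ε))) ≤
      oscSum (t • g - x) ((2 : ℝ)⁻¹ ^ n) := by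
  set A : ℕ → Set ℝ := fun n => {t | oscSum (t • g - x) ((2 : ℝ)⁻¹ ^ n) <
    ENNReal.ofReal ((2 : ℝ) ^ ((n : ℝ) * (α - 1 - ε)))} with hA
  set r : ℝ := (2 : ℝ) ^ (-ε) with hr
  have hr0 : 0 < r := by positivity
  have hr1 : r < 1 := Real.rpow_lt_one_of_one_lt_of_neg one_lt_two (by linarith)
  -- For `t, s ∈ A n` one has `|t - s| 2^(n(α-1)) / (2(n+1)²) ≤ 2 · 2^(n(α-1)) rⁿ`, which is `|t -
  -- s| ≤ b n`.
  set b : ℕ → ℝ := fun n => 4 * ((n : ℝ) + 1) ^ 2 * r ^ n with hb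
  have hvol : ∀ n, MeasureTheory.volume (A n) ≤ ENNReal.ofReal (b n) := by
    intro n
    -- Bounding the outer measure by the diameter makes the measurability of `A n` irrelevant.
    refine (Real.volume_le_diam _).trans (Metric.ediam_le fun t ht s hs => ?_)
    have h1 := (ofReal_abs_sub_mul_oscSum_le g x ((2 : ℝ)⁻¹ ^ n) t s).trans
      (add_le_add (le_of_lt ht) (le_of_lt hs))
    have h2 := (mul_le_mul_right (hg n) (ENNReal.ofReal |t - s|)).trans h1
    rw [← ENNReal.ofReal_mul (abs_nonneg _), ← ENNReal.ofReal_add (by positivity) (by positivity),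
      ENNReal.ofReal_le_ofReal_iff (by positivity)] at h2
    rw [edist_dist, Real.dist_eq]
    refine ENNReal.ofReal_le_ofReal ?_
    have hP : (0 : ℝ) < (2 : ℝ) ^ ((n : ℝ) * (α - 1)) := by positivity
    have e : (2 : ℝ) ^ ((n : ℝ) * (α - 1 - ε)) = (2 : ℝ) ^ ((n : ℝ) * (α - 1)) * r ^ n := by
      rw [hr, ← Real.rpow_natCast, ← Real.rpow_mul two_pos.le, ← Real.rpow_add two_pos]
      ring_nf
    rw [e, mul_div_assoc', div_le_iff₀ (by positivity)] at h2
    refine le_of_mul_le_mul_right ?_ hP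
    calc _ ≤ _ := h2
      _ = _ := by rw [hb]; ring
  have hsum : Summable b := by
    have h2 := summable_pow_mul_geometric_of_norm_lt_one (R := ℝ) 2 (r := r)
      (by rwa [Real.norm_of_nonneg hr0.le])
    have h1 := summable_pow_mul_geometric_of_norm_lt_one (R := ℝ) 1 (r := r)
      (by rwa [Real.norm_of_nonneg hr0.le])
    have h0 := summable_pow_mul_geometric_of_norm_lt_one (R := ℝ) 0 (r := r)
      (by rwa [Real.norm_of_nonneg hr0.le])
    refine (((h2.add (h1.mul_left 2)).add h0).mul_left 4).congr fun n => ?_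
    rw [hb]
    ring
  have hfin : ∑' n, MeasureTheory.volume (A n) ≠ ∞ := by
    refine ne_top_of_le_ne_top ?_ (ENNReal.tsum_le_tsum hvol)
    exact hsum.tsum_ofReal_ne_top
  filter_upwards [MeasureTheory.ae_eventually_notMem hfin] with t ht
  filter_upwards [ht] with n hn
  exact not_lt.1 hn

/-- Translates of almost all multiples of `g` have large lower box dimension. -/
theorem ae_le_lowerBoxDim {d : ℕ} {α : ℝ} (hα : 1 ≤ α) {g : C(UnitCube d, ℝ)}
    (hg : ∀ n : ℕ, ENNReal.ofReal ((2 : ℝ) ^ ((n : ℝ) * (α - 1)) / (2 * ((n : ℝ) + 1) ^ 2)) ≤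
      oscSum g ((2 : ℝ)⁻¹ ^ n)) (x : C(UnitCube d, ℝ)) :
    ∀ᵐ t : ℝ, (α : EReal) ≤ lowerBoxDim (graphSet (t • g - x)) := by
  have h := MeasureTheory.ae_all_iff.2 fun k : ℕ =>
    ae_eventually_le_oscSum (α := α) (Nat.one_div_pos_of_nat (α := ℝ) (n := k)) hg x
  filter_upwards [h] with t ht
  rw [le_lowerBoxDim_iff (isBounded_graphSet _) hα]
  intro k
  filter_upwards [ht k] with n hn
  have hδ : (0 : ℝ) < 2⁻¹ ^ n := by positivity
  -- Division by `δ = 2⁻ⁿ` turns the exponent `n(α - 1 - ε)` into `n(α - ε)`.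
  have h1 := hn.trans (oscSum_le _ hδ)
  rw [← ENNReal.ofReal_natCast, ← ENNReal.ofReal_mul hδ.le,
    ENNReal.ofReal_le_ofReal_iff (by positivity)] at h1
  refine le_of_mul_le_mul_left ?_ hδ
  refine le_of_eq_of_le ?_ h1
  rw [inv_pow, ← Real.rpow_natCast, ← Real.rpow_neg two_pos.le, ← Real.rpow_add two_pos]
  ring_nf

/-- With `g` as basis of the probe, `t • g ∈ F + x` is equivalent to `t • g - x ∈ F`. The rest
identifies `Fin 1 → ℝ` with `ℝ` as measure spaces. -/
theorem isKPrevalent_one_of_ae {X : Type*} [AddCommGroup X] [Module ℝ X] [TopologicalSpace X]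
    {F : Set X} (hF : @MeasurableSet X (borel X) F) {g : X}
    (hg : g ≠ 0) (h : ∀ x : X, ∀ᵐ t : ℝ, t • g - x ∈ F) : IsKPrevalent 1 F := by
  refine ⟨hF, _, (Module.Basis.singleton (Fin 1) ℝ).map
    (LinearEquiv.toSpanNonzeroSingleton ℝ X g hg), fun x => ?_⟩
  have h1 := (MeasureTheory.volume_preserving_funUnique (Fin 1) ℝ).quasiMeasurePreserving.ae (h x)
  rw [MeasureTheory.ae_iff] at h1
  refine MeasureTheory.measure_mono_null (fun t ht => ?_) h1
  simp only [Set.mem_ofPred_eq, Set.mem_compl_iff, Set.mem_image, not_exists, not_and] at ht ⊢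
  intro hmem
  refine ht _ hmem ?_
  simp

/-- Below distance `1/2` the first term of the metric is the full norm `‖·‖_{α+1,d}`, which
dominates the sup norm. Continuity lets Borel sets of `C[0,1]^d` be pulled back to `C_α[0,1]^d`. -/
theorem CAlpha.continuous_toC {d : ℕ} {α : ℝ} {hα : (d : ℝ) ≤ α} :
    Continuous (toC : CAlpha d α hα → C(UnitCube d, ℝ)) := by
  refine EMetric.continuous_iff.2 fun f ε hε => ?_
  refine ⟨min ε ((2 : ℝ≥0∞)⁻¹ ^ (0 + 1)), lt_min hε (half_pow_pos _), fun g hg => ?_⟩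
  rw [edist_eq] at hg
  have h1 := oscNorm_le_of_distFun (k := 0) le_rfl (hg.trans_le (min_le_right _ _))
  rw [edist_dist, dist_eq_norm]
  exact ((norm_le_oscNorm _ _).trans h1).trans_lt (hg.trans_le (min_le_left _ _))

/-- Needed for `g` to span a line; the scale `n = 0` already gives an oscillation sum of at least
`1/2`. -/
theorem ne_zero_of_le_oscSum {d : ℕ} {α : ℝ} {g : C(UnitCube d, ℝ)}
    (hg : ∀ n : ℕ, ENNReal.ofReal ((2 : ℝ) ^ ((n : ℝ) * (α - 1)) / (2 * ((n : ℝ) + 1) ^ 2)) ≤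
      oscSum g ((2 : ℝ)⁻¹ ^ n)) : g ≠ 0 := by
  intro h0
  have h1 : oscSum g ((2 : ℝ)⁻¹ ^ 0) ≤ ENNReal.ofReal |0| * oscSum g ((2 : ℝ)⁻¹ ^ 0) :=
    le_trans (by rw [zero_smul, h0]) (oscSum_smul 0 g _)
  rw [abs_zero, ENNReal.ofReal_zero, zero_mul] at h1
  have h2 := ENNReal.ofReal_eq_zero.1 (nonpos_iff_eq_zero.1 ((hg 0).trans h1))
  exact absurd h2 (not_le.2 (by positivity))

end GraphDim

/-! ### The main theorem -/

theorem theorem1p1 (d : ℕ) (hd : 1 ≤ d) :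
    GraphDim.IsKPrevalent 1 (GraphDim.graphDimEq d ((d : ℝ) + 1)) ∧
    ∀ (α : ℝ) (hα : (d : ℝ) ≤ α), α < (d : ℝ) + 1 →
      GraphDim.IsKPrevalent 1
        {f : GraphDim.CAlpha d α hα | GraphDim.CAlpha.toC f ∈ GraphDim.graphDimEq d α} := by
  have hd1 : (1 : ℝ) ≤ d := by exact_mod_cast hd
  constructor
  · have hg := GraphDim.le_oscSum_takagiCube (⟨0, hd⟩ : Fin d) (α := (d : ℝ) + 1) (by linarith)
    refine GraphDim.isKPrevalent_one_of_ae (GraphDim.measurableSet_graphDimEq hd (by linarith))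
      (GraphDim.ne_zero_of_le_oscSum hg) fun x => ?_
    filter_upwards [GraphDim.ae_le_lowerBoxDim (by linarith) hg x] with t ht
    exact GraphDim.mem_graphDimEq_iff.2 ⟨ht, GraphDim.upperBoxDim_graphSet_le _⟩
  · intro α hα hα1
    have hs : α - d ≤ 1 := by linarith
    have hg := GraphDim.le_oscSum_takagiCube (⟨0, hd⟩ : Fin d) hs
    -- The Hölder bound places the Takagi type function in `C_α[0,1]^d`, so its span is a legitimate
    -- probe there.
    obtain ⟨g, hgC⟩ := GraphDim.CAlpha.exists_toC_eq (hα := hα)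
      (GraphDim.upperBoxDim_takagiCube_le (⟨0, hd⟩ : Fin d) hα hs)
    rw [← hgC] at hg
    refine GraphDim.isKPrevalent_one_of_ae (g := g) ?_ ?_ fun x => ?_
    · exact (@Continuous.borel_measurable _ _ _ _ _ GraphDim.CAlpha.continuous_toC)
        (GraphDim.measurableSet_graphDimEq hd hα)
    · rintro rfl
      exact GraphDim.ne_zero_of_le_oscSum hg (map_zero _)
    · filter_upwards [GraphDim.ae_le_lowerBoxDim (hd1.trans hα) hg (GraphDim.CAlpha.toC x)]
        with t ht
      -- The upper bound is automatic because `t • g - x` belongs to the linear space.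
      refine GraphDim.mem_graphDimEq_iff.2 ⟨?_, GraphDim.CAlpha.upperBoxDim_toC _⟩
      rwa [map_sub, map_smul]
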